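/- Let $\mathcal H^s$ denote $s$-dimensional Hausdorff measure on $\mathbb C$. A gauge function is a continuous non-decreasing $h:[0,\infty)\to[0,\infty)$ with $h(t)\to 0$ as $t\to0$ and $h(t)>0$ for $t>0$; $\mathcal H^h$ denotes the Hausdorff measure with gauge $h$, i.e. $\mathcal H^h(A)=\lim_{\delta\to0}\inf\sum_j h(\operatorname{diam}A_j)$ over countable covers $(A_j)$ of $A$ by sets of diameter at most $\delta$. For $K\ge1$, a $K$-quasiconformal mapping $\varphi:\mathbb C\to\mathbb C$ is an orientation preserving homeomorphism in $W^{1,2}_{loc}(\mathbb C)$ with $\max_\alpha|\partial_\alpha\varphi|\le K\min_\alpha|\partial_\alpha\varphi|$ almost everywhere. Corollary 3.3. The implication "$\mathcal H^{2/(K+1)}(E)=0\Rightarrow\mathcal H^1(\varphi(E))=0$ for all compact $E\subset\mathbb C$ and all $K$-quasiconformal $\varphi$" has a sharp hypothesis: no relaxation of the hypothesis in terms of gauge functions allows the same conclusion. More precisely, for every $K\ge1$ there exist a compact set $E\subset\mathbb C$ and a $K$-quasiconformal mapping $\varphi:\mathbb C\to\mathbb C$ such that $$0<\mathcal H^{2/(K+1)}(E)<\infty,\qquad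 0<\mathcal H^{1}(\varphi(E))<\infty,$$ and such that $\mathcal H^h(E)=0$ for every gauge function $h$ with $h(t)/t^{2/(K+1)}\to0$ as $t\to0^+$ (so that for each such $h$ the hypothesis $\mathcal H^h(E)=0$ does not imply $\mathcal H^1(\varphi(E))=0$). -/

import Mathlib

open MeasureTheory Filter Topology
open scoped NNReal ENNReal ContDiff

/-- `D` is the (total) weak derivative of `f : ℂ → ℂ` on the whole plane: both are locally
integrable and `∫ (∂_v η) f = -∫ η (D v)` for all real smooth compactly supported test functions
`η` and all directions `v`. Thus `D z v` is the weak directional derivative `∂_v f (z)`. -/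
def HasWeakFDeriv (f : ℂ → ℂ) (D : ℂ → ℂ →L[ℝ] ℂ) : Prop :=
  LocallyIntegrable f ∧ LocallyIntegrable D ∧
    ∀ η : ℂ → ℝ, ContDiff ℝ ∞ η → HasCompactSupport η → ∀ v : ℂ,
      ∫ z, (fderiv ℝ η z v) • f z = - ∫ z, (η z) • (D z v)

/-- `f` is square integrable on every compact set. -/
def MemL2Loc {F : Type*} [NormedAddCommGroup F] (f : ℂ → F) : Prop :=
  ∀ S : Set ℂ, IsCompact S → MemLp f 2 (volume.restrict S)

/-- Positive orientation of a homeomorphism `φ` of the plane: for every circle with centre `a` and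
radius `r`, the image of the circle, traversed once counterclockwise, winds exactly once
counterclockwise around `φ a`. The winding number is read off from a continuous branch `g` of
`log (φ (a + r e^{iθ}) - φ a)` along the circle. -/
def OrientationPreserving (φ : ℂ → ℂ) : Prop :=
  ∀ (a : ℂ) (r : ℝ), 0 < r → ∃ g : ℝ → ℂ, Continuous g ∧
    (∀ θ : ℝ, Complex.exp (g θ) = φ (a + r * Complex.exp (θ * Complex.I)) - φ a) ∧
    g (2 * Real.pi) = g 0 + 2 * Real.pi * Complex.I

/-- `φ : ℂ → ℂ` is `K`-quasiconformal: an orientation preserving homeomorphism of the plane in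
`W^{1,2}_loc(ℂ)` with `max_α |∂_α φ| ≤ K min_α |∂_α φ|` almost everywhere, where
`∂_α φ (z) = D z (e^{iα})` is the derivative in the direction of angle `α`. -/
def IsQuasiconformal (K : ℝ) (φ : ℂ → ℂ) : Prop :=
  IsHomeomorph φ ∧ OrientationPreserving φ ∧ MemL2Loc φ ∧
    ∃ D : ℂ → ℂ →L[ℝ] ℂ, HasWeakFDeriv φ D ∧ MemL2Loc D ∧
      ∀ᵐ z : ℂ, ∀ α β : ℝ,
        ‖D z (Complex.exp (α * Complex.I))‖ ≤ K * ‖D z (Complex.exp (β * Complex.I))‖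

/-- A gauge (measure) function: continuous, non-decreasing on `[0, ∞)`, tending to `0` at `0`,
positive at positive arguments. -/
structure IsGaugeFunction (h : ℝ≥0 → ℝ≥0) : Prop where
  continuous : Continuous h
  monotone : Monotone h
  tendsto_zero : Tendsto h (𝓝[>] 0) (𝓝 0)
  pos : ∀ t, 0 < t → 0 < h t

/-- The generalized Hausdorff measure with gauge function `h` on the plane,
`lim_{δ → 0} inf { ∑ h (diam A_j) : (A_j) a countable cover by sets of diameter at most δ }`.
Only sets of small diameter matter, so the value of `ENNReal.toNNReal` at `∞` plays no role. -/
noncomputable def gaugeHausdorffMeasure (h : ℝ≥0 → ℝ≥0) : Measure ℂ :=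
  Measure.mkMetric fun x : ℝ≥0∞ => (h x.toNNReal : ℝ≥0∞)

/-! The set and its image belong to one family of Cantor sets indexed by an exponent `p`. Fix finite
packings `P n` of the unit disc by disjoint discs of radii r ≤ 1/2 whose sums of r² are so close to
1 that their product over n stays positive. Iterate the packings, shrinking each disc B(c, r) to
B(c, r^p) before the next generation is inserted. Since (r^p)^(2/p) = r², the natural covers have
bounded 2/p-sums, so the limit set has finite 2/p-measure (`hausdorffMeasure_limitSet_lt_top`). For
p ≥ 2 the measure is also positive: the set with exponent 1 has positive area, and that area is
pushed onto the set with exponent p. Shrunken discs are far apart relative to their radii, so a set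
of diameter d receives mass at most a constant times d^(2/p) (`volume_inter_preimage_le`), and the
mass distribution principle applies.

Take E with exponent K + 1 and its image with exponent 2. On each disc the annulus r^(K+1) ≤ |z - c|
≤ r goes onto r² ≤ |z - c| ≤ r by a rescaled copy of w ↦ |w|^(1/K - 1) w, whose distortion is K, and
a similar copy of the next generation is put inside. Similarities preserve distortion, so every
iterate has distortion at most K (`aeBeltrami_stretchIter`). The iterates converge uniformly;
exchanging the two exponents inverts them, so the limit φ is a homeomorphism
(`exists_stretch_limit`). It agrees with the m-th iterate off a set of area at most π/4^m. This
gives the distortion bound almost everywhere, the area formula gives square integrability, and the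
weak derivative follows by letting m → ∞ (`integral_fderiv_smul_of_stretch_limit`).

For the gauges, finiteness of the 2/(K+1)-measure of E is enough: h(t) ≤ ε t^(2/(K+1)) for small t
and every ε > 0. -/

/-! ### Orientation via winding numbers -/

theorem exists_continuous_exp_eq {G : ℝ × ℝ → ℂ} (hG : Continuous G) (h0 : ∀ x, G x ≠ 0) :
    ∃ g : ℝ × ℝ → ℂ, Continuous g ∧ ∀ x, Complex.exp (g x) = G x := by
  obtain ⟨F, ⟨-, hF⟩, -⟩ := Complex.isCoveringMapOn_exp.existsUnique_continuousMap_lifts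
    (f := (⟨G, hG⟩ : C(ℝ × ℝ, ℂ))) (a₀ := (0, 0)) (e₀ := Complex.log (G (0, 0)))
    (Complex.exp_log (h0 _)) (fun x => h0 x)
  exact ⟨F, F.continuous, fun x => congrFun hF x⟩

theorem continuous_of_continuous_intCast {n : ℝ → ℤ} (h : Continuous fun s => (n s : ℂ)) :
    Continuous n := by
  have h2 : Continuous fun s => ((n s : ℤ) : ℝ) :=
    (Complex.continuous_re.comp h).congr fun s => by simp
  exact Int.isClosedEmbedding_coe_real.isEmbedding.continuous_iff.2 h2

/-- The winding number is a continuous integer-valued function of the radius, hence constant, and it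
is 1 on large circles, where the map is the identity. The radius is written as an exponential so
that the parameter space is the whole plane, where logarithms lift. -/
theorem orientationPreserving_of_eq_self_of_one_le_norm {φ : ℂ → ℂ} (hc : Continuous φ)
    (hi : Function.Injective φ) (hid : ∀ z, 1 ≤ ‖z‖ → φ z = z) : OrientationPreserving φ := by
  intro a r hr
  set G : ℝ × ℝ → ℂ := fun x =>
    φ (a + (Real.exp x.1 : ℝ) * Complex.exp (x.2 * Complex.I)) - φ a with hGdef
  have hG : Continuous G := by fun_prop
  have h0 : ∀ x, G x ≠ 0 := by
    intro x hx
    have := hi (sub_eq_zero.1 hx)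
    simp [Complex.exp_ne_zero] at this
  obtain ⟨g, hgc, hg⟩ := exists_continuous_exp_eq hG h0
  set d : ℝ → ℂ := fun s => (g (s, 2 * Real.pi) - g (s, 0)) / (2 * Real.pi * Complex.I) with hd
  have hpi : (2 * Real.pi * Complex.I : ℂ) ≠ 0 := Complex.two_pi_I_ne_zero
  have hdint : ∀ s, ∃ n : ℤ, d s = n := by
    intro s
    have : Complex.exp (g (s, 2 * Real.pi)) = Complex.exp (g (s, 0)) := by
      rw [hg, hg]; simp [hGdef, Complex.exp_two_pi_mul_I]
    obtain ⟨n, hn⟩ := Complex.exp_eq_exp_iff_exists_int.1 this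
    exact ⟨n, by rw [hd]; simp only; rw [hn]; field_simp; ring⟩
  choose n hn using hdint
  have hncont : Continuous n := by
    have h1 : Continuous fun s => ((n s : ℤ) : ℂ) := by
      have : (fun s => ((n s : ℤ) : ℂ)) = d := funext fun s => (hn s).symm
      rw [this]; fun_prop
    exact continuous_of_continuous_intCast h1
  have hconst : ∀ s t, n s = n t := fun s t =>
    PreconnectedSpace.constant inferInstance hncont
  -- far away from the unit disc the logarithm is explicit
  obtain ⟨S, hS⟩ : ∃ S : ℝ, ‖a‖ + 1 + ‖a - φ a‖ < Real.exp S := by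
    obtain ⟨S, hS⟩ := (Real.tendsto_exp_atTop.eventually_gt_atTop (‖a‖ + 1 + ‖a - φ a‖)).exists
    exact ⟨S, hS⟩
  have hnS : n S = 1 := by
    -- On this circle φ is the identity, so φ(·) - φ a = e^(S+iθ) (1 + (a - φ a) / e^(S+iθ)). The
    -- choice of S makes the quotient less than 1 in norm, so the principal logarithm is continuous
    -- there.
    set u : ℝ → ℂ := fun θ => S + θ * Complex.I +
      Complex.log (1 + (a - φ a) / Complex.exp (S + θ * Complex.I)) with hu
    have hexpn : ∀ θ : ℝ, ‖Complex.exp (S + θ * Complex.I)‖ = Real.exp S := by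
      intro θ; simp [Complex.norm_exp]
    have hsmall : ∀ θ : ℝ, ‖(a - φ a) / Complex.exp (S + θ * Complex.I)‖ < 1 := by
      intro θ
      rw [norm_div, hexpn, div_lt_one (Real.exp_pos _)]
      nlinarith [norm_nonneg a]
    have hslit : ∀ θ : ℝ, 1 + (a - φ a) / Complex.exp (S + θ * Complex.I) ∈ Complex.slitPlane :=
      fun θ => Complex.mem_slitPlane_of_norm_lt_one (hsmall θ)
    have hucont : Continuous u := by
      refine Continuous.add (by fun_prop) (Continuous.clog ?_ hslit)
      exact continuous_const.add (continuous_const.div (by fun_prop) fun θ => Complex.exp_ne_zero _)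
    have huexp : ∀ θ, Complex.exp (u θ) = G (S, θ) := by
      intro θ
      have hne : (1 : ℂ) + (a - φ a) / Complex.exp (S + θ * Complex.I) ≠ 0 :=
        Complex.slitPlane_ne_zero (hslit θ)
      rw [hu]; simp only
      rw [Complex.exp_add, Complex.exp_log hne, hGdef]; simp only
      have he : ((Real.exp S : ℝ) : ℂ) * Complex.exp (θ * Complex.I)
          = Complex.exp (S + θ * Complex.I) := by
        rw [Complex.exp_add, Complex.ofReal_exp]
      rw [he, hid (a + Complex.exp (S + θ * Complex.I))]
      · field_simp [Complex.exp_ne_zero]; ring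
      · have h1 := norm_sub_norm_le (Complex.exp (S + θ * Complex.I)) (-a)
        rw [hexpn, norm_neg, sub_neg_eq_add] at h1
        rw [add_comm]
        linarith [norm_nonneg (a - φ a)]
    have hdiff : ∀ θ, ∃ k : ℤ, (g (S, θ) - u θ) / (2 * Real.pi * Complex.I) = k := by
      intro θ
      have : Complex.exp (g (S, θ)) = Complex.exp (u θ) := by rw [hg, huexp]
      obtain ⟨k, hk⟩ := Complex.exp_eq_exp_iff_exists_int.1 this
      exact ⟨k, by rw [hk]; field_simp; ring⟩
    choose k hk using hdiff
    have hkcont : Continuous k := by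
      have h1 : Continuous fun s => ((k s : ℤ) : ℂ) := by
        have : (fun s => ((k s : ℤ) : ℂ)) = fun θ => (g (S, θ) - u θ) / (2 * Real.pi * Complex.I) :=
          funext fun s => (hk s).symm
        rw [this]; fun_prop
      exact continuous_of_continuous_intCast h1
    have hkc : k (2 * Real.pi) = k 0 := PreconnectedSpace.constant inferInstance hkcont
    have e1 := hk (2 * Real.pi)
    have e2 := hk 0
    rw [hkc, ← e2, div_left_inj' hpi] at e1
    have e3 := hn S
    have e4 : u (2 * Real.pi) = u 0 + 2 * Real.pi * Complex.I := by
      simp only [hu]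
      have : Complex.exp (S + ((2 * Real.pi : ℝ) : ℂ) * Complex.I) =
          Complex.exp (S + ((0 : ℝ) : ℂ) * Complex.I) := by
        rw [Complex.exp_add, Complex.exp_add]
        push_cast
        rw [Complex.exp_two_pi_mul_I]; simp
      rw [this]; push_cast; ring
    have e5 : g (S, 2 * Real.pi) - g (S, 0) = 2 * Real.pi * Complex.I := by
      linear_combination e1 + e4
    rw [hd] at e3
    simp only [e5] at e3
    rw [div_self hpi] at e3
    exact_mod_cast e3.symm
  refine ⟨fun θ => g (Real.log r, θ), by fun_prop, fun θ => ?_, ?_⟩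
  · rw [hg, hGdef]; simp only; rw [Real.exp_log hr]
  · have := hn (Real.log r)
    rw [hconst _ S, hnS, hd] at this
    simp only at this
    rw [div_eq_iff hpi] at this
    push_cast at this
    linear_combination this

/-! ### Packings of the disc and similarities -/

/-- A finite packing of the unit disc by pairwise disjoint closed discs of radius at most `1/2`. -/
structure DiscPacking where
  centers : Finset ℂ
  radius : ℂ → ℝ
  radius_pos : ∀ c ∈ centers, 0 < radius c
  radius_le : ∀ c ∈ centers, radius c ≤ 1 / 2
  disjoint : ∀ c ∈ centers, ∀ c' ∈ centers, c ≠ c' → radius c + radius c' < dist c c'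
  norm_add_radius_le : ∀ c ∈ centers, ‖c‖ + radius c ≤ 1

theorem volume_closedBall_complex (c : ℂ) {r : ℝ} (hr : 0 ≤ r) :
    volume (Metric.closedBall c r) = ENNReal.ofReal (Real.pi * r ^ 2) := by
  rw [Complex.volume_closedBall, ← ENNReal.ofReal_pow hr, mul_comm,
    ENNReal.ofReal_mul Real.pi_pos.le]
  congr 1
  rw [← NNReal.coe_real_pi, ENNReal.ofReal_coe_nnreal]

theorem DiscPacking.sum_sq_eq_volume (P : DiscPacking) {s : Finset ℂ} (hs : s ⊆ P.centers) :
    ENNReal.ofReal (Real.pi * ∑ c ∈ s, P.radius c ^ 2) =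
      volume (⋃ c ∈ s, Metric.closedBall c (P.radius c)) := by
  rw [measure_biUnion_finset]
  · rw [Finset.mul_sum, ENNReal.ofReal_sum_of_nonneg fun c _ => by positivity]
    refine Finset.sum_congr rfl fun c hc => ?_
    rw [volume_closedBall_complex c (P.radius_pos c (hs hc)).le]
  · intro c hc c' hc' hne
    exact Metric.closedBall_disjoint_closedBall (P.disjoint c (hs hc) c' (hs hc') hne)
  · exact fun c _ => Metric.isClosed_closedBall.measurableSet

theorem DiscPacking.sum_sq_le_of_subset (P : DiscPacking) {s : Finset ℂ} (hs : s ⊆ P.centers)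
    {x : ℂ} {ρ : ℝ} (hρ : 0 ≤ ρ)
    (h : ∀ c ∈ s, Metric.closedBall c (P.radius c) ⊆ Metric.closedBall x ρ) :
    ∑ c ∈ s, P.radius c ^ 2 ≤ ρ ^ 2 := by
  have h1 : ENNReal.ofReal (Real.pi * ∑ c ∈ s, P.radius c ^ 2)
      ≤ ENNReal.ofReal (Real.pi * ρ ^ 2) := by
    rw [P.sum_sq_eq_volume hs, ← volume_closedBall_complex x hρ]
    exact measure_mono (Set.iUnion₂_subset h)
  rw [ENNReal.ofReal_le_ofReal_iff (by positivity)] at h1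
  exact le_of_mul_le_mul_left h1 Real.pi_pos

theorem DiscPacking.closedBall_subset (P : DiscPacking) {c : ℂ} (hc : c ∈ P.centers) :
    Metric.closedBall c (P.radius c) ⊆ Metric.closedBall 0 1 := by
  refine Metric.closedBall_subset_closedBall' ?_
  rw [dist_zero_right, add_comm]
  exact P.norm_add_radius_le c hc

theorem DiscPacking.sum_sq_le_one (P : DiscPacking) : ∑ c ∈ P.centers, P.radius c ^ 2 ≤ 1 := by
  simpa using P.sum_sq_le_of_subset subset_rfl zero_le_one fun c hc => P.closedBall_subset hc

/-- The Besicovitch covering theorem fills the open disc up to a null set with countably many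
disjoint closed discs; a finite subfamily already carries any smaller proportion of the area. -/
theorem exists_discPacking {a : ℝ} (ha : a < 1) :
    ∃ P : DiscPacking, a ≤ ∑ c ∈ P.centers, P.radius c ^ 2 := by
  obtain ⟨t, r, htc, hts, hr, hvol, hdisj⟩ := Besicovitch.exists_disjoint_closedBall_covering_ae
    (volume : Measure ℂ) (fun _ => Set.univ) (Metric.ball 0 1)
    (fun x _ δ hδ => by simpa using hδ) (fun x => min (1 / 2) (1 - ‖x‖))
    (fun x hx => by simpa using hx)
  have hpack : ∀ s : Finset ℂ, (s : Set ℂ) ⊆ t → ∃ P : DiscPacking, P.centers = s ∧ P.radius = r :=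
    fun s hs => ⟨
      { centers := s
        radius := r
        radius_pos := fun c hc => (hr c (hs hc)).2.1
        radius_le := fun c hc => ((hr c (hs hc)).2.2.trans_le (min_le_left _ _)).le
        disjoint := fun c hc c' hc' hne =>
          (disjoint_closedBall_closedBall_iff (hr c (hs hc)).2.1.le (hr c' (hs hc')).2.1.le).1
            (hdisj (hs hc) (hs hc') hne)
        norm_add_radius_le := fun c hc => by
          have := (hr c (hs hc)).2.2.trans_le (min_le_right _ _)
          linarith }, rfl, rfl⟩
  have hle : ENNReal.ofReal (Real.pi * 1) ≤ volume (⋃ x ∈ t, Metric.closedBall x (r x)) := by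
    have h1 : volume (Metric.ball (0 : ℂ) 1) = ENNReal.ofReal (Real.pi * 1) := by
      rw [← Measure.addHaar_closedBall_eq_addHaar_ball, volume_closedBall_complex 0 zero_le_one]
      norm_num
    rw [← h1]
    refine (measure_le_inter_add_sdiff _ _ (⋃ x ∈ t, Metric.closedBall x (r x))).trans ?_
    rw [hvol, add_zero]
    exact measure_mono Set.inter_subset_right
  have hlt : ENNReal.ofReal (Real.pi * a) < volume (⋃ x ∈ t, Metric.closedBall x (r x)) := by
    refine lt_of_lt_of_le ?_ hle
    rw [ENNReal.ofReal_lt_ofReal_iff (by positivity)]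
    exact mul_lt_mul_of_pos_left ha Real.pi_pos
  have hsum : volume (⋃ x ∈ t, Metric.closedBall x (r x)) =
      ∑' x : t, volume (Metric.closedBall (x : ℂ) (r x)) :=
    measure_biUnion htc hdisj fun c _ => Metric.isClosed_closedBall.measurableSet
  rw [hsum, ENNReal.tsum_eq_iSup_sum, lt_iSup_iff] at hlt
  obtain ⟨s, hs⟩ := hlt
  obtain ⟨P, hPs, hPr⟩ := hpack (s.map (Function.Embedding.subtype _)) (by
    intro x hx
    simp only [Finset.coe_map, Set.mem_image] at hx
    obtain ⟨y, -, rfl⟩ := hx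
    exact y.2)
  refine ⟨P, ?_⟩
  have h2 : ENNReal.ofReal (Real.pi * a) <
      ENNReal.ofReal (Real.pi * ∑ c ∈ P.centers, P.radius c ^ 2) := by
    refine hs.trans_eq ?_
    rw [Finset.mul_sum, ENNReal.ofReal_sum_of_nonneg fun c _ => by positivity, hPs, hPr,
      Finset.sum_map]
    refine Finset.sum_congr rfl fun c _ => ?_
    rw [volume_closedBall_complex _ (hr c c.2).2.1.le]
    rfl
  by_contra hcon
  refine h2.not_ge (ENNReal.ofReal_le_ofReal ?_)
  exact mul_le_mul_of_nonneg_left (not_le.1 hcon).le Real.pi_pos.le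

/-- The similarity taking the disc with centre `c` and radius `ρ` to the unit disc. -/
noncomputable def zoom (c : ℂ) (ρ : ℝ) (x : ℂ) : ℂ := ρ⁻¹ • (x - c)

theorem zoom_mem_closedBall_iff {c x : ℂ} {ρ : ℝ} (hρ : 0 < ρ) :
    zoom c ρ x ∈ Metric.closedBall 0 1 ↔ x ∈ Metric.closedBall c ρ := by
  rw [mem_closedBall_zero_iff, mem_closedBall_iff_norm, zoom, norm_smul, norm_inv,
    Real.norm_of_nonneg hρ.le, inv_mul_le_iff₀ hρ, mul_one]

theorem norm_zoom {c x : ℂ} {ρ : ℝ} (hρ : 0 < ρ) : ‖zoom c ρ x‖ = ‖x - c‖ / ρ := by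
  rw [zoom, norm_smul, norm_inv, Real.norm_of_nonneg hρ.le, inv_mul_eq_div]

theorem add_smul_zoom {c x : ℂ} {ρ : ℝ} (hρ : ρ ≠ 0) : c + ρ • zoom c ρ x = x := by
  rw [zoom, smul_inv_smul₀ hρ]; ring

theorem zoom_add_smul {c x : ℂ} {ρ : ℝ} (hρ : ρ ≠ 0) : zoom c ρ (c + ρ • x) = x := by
  rw [zoom, add_sub_cancel_left, inv_smul_smul₀ hρ]

theorem zoom_smul_sub {c x : ℂ} {ρ : ℝ} (hρ : ρ ≠ 0) : ρ • zoom c ρ x = x - c := by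
  rw [zoom, smul_inv_smul₀ hρ]

@[fun_prop]
theorem continuous_zoom (c : ℂ) (ρ : ℝ) : Continuous (zoom c ρ) := by
  unfold zoom; fun_prop

theorem volume_zoom_preimage (c : ℂ) {ρ : ℝ} (hρ : 0 < ρ) (A : Set ℂ) :
    volume (zoom c ρ ⁻¹' A) = ENNReal.ofReal (ρ ^ 2) * volume A := by
  have : zoom c ρ ⁻¹' A = (fun x => x + -c) ⁻¹' ((ρ⁻¹ • ·) ⁻¹' A) := by
    ext x; simp only [Set.mem_preimage, zoom, sub_eq_add_neg]
  rw [this, measure_preimage_add_right, Measure.addHaar_preimage_smul _ (inv_ne_zero hρ.ne')]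
  rw [Complex.finrank_real_complex, inv_pow, inv_inv, abs_of_pos (by positivity)]

namespace DiscPacking

theorem radius_rpow_pos (P : DiscPacking) {c : ℂ} (hc : c ∈ P.centers) (p : ℝ) :
    0 < P.radius c ^ p := Real.rpow_pos_of_pos (P.radius_pos c hc) p

theorem radius_rpow_le (P : DiscPacking) {c : ℂ} (hc : c ∈ P.centers) {p : ℝ} (hp : 1 ≤ p) :
    P.radius c ^ p ≤ P.radius c := by
  have h := P.radius_le c hc
  simpa using Real.rpow_le_rpow_of_exponent_ge (P.radius_pos c hc) (by linarith) hp

theorem radius_rpow_le_half (P : DiscPacking) {c : ℂ} (hc : c ∈ P.centers) {p : ℝ} (hp : 1 ≤ p) :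
    P.radius c ^ p ≤ 1 / 2 :=
  (P.radius_rpow_le hc hp).trans (P.radius_le c hc)

theorem radius_rpow_le_radius_div_two (P : DiscPacking) {c : ℂ} (hc : c ∈ P.centers) {p : ℝ}
    (hp : 2 ≤ p) : P.radius c ^ p ≤ P.radius c / 2 := by
  have h := P.radius_le c hc
  have h0 := P.radius_pos c hc
  have h1 := Real.rpow_le_rpow_of_exponent_ge h0 (by linarith) hp
  rw [Real.rpow_two] at h1
  nlinarith

theorem eq_of_mem_closedBall (P : DiscPacking) {c c' z : ℂ} (hc : c ∈ P.centers)
    (hc' : c' ∈ P.centers) (hz : z ∈ Metric.closedBall c (P.radius c))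
    (hz' : z ∈ Metric.closedBall c' (P.radius c')) : c = c' := by
  by_contra hne
  exact Set.disjoint_left.1
    (Metric.closedBall_disjoint_closedBall (P.disjoint c hc c' hc' hne)) hz hz'

theorem sum_eq_of_mem_closedBall (P : DiscPacking) {f : ℂ → ℂ} {c z : ℂ} (hc : c ∈ P.centers)
    (hz : z ∈ Metric.closedBall c (P.radius c))
    (h : ∀ c' ∈ P.centers, z ∉ Metric.closedBall c' (P.radius c') → f c' = 0) :
    ∑ c' ∈ P.centers, f c' = f c :=
  Finset.sum_eq_single_of_mem c hc fun c' hc' hne =>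
    h c' hc' fun hz' => hne (P.eq_of_mem_closedBall hc' hc hz' hz)

theorem zoom_rpow_mem_subset (P : DiscPacking) {c z : ℂ} (hc : c ∈ P.centers) {p : ℝ}
    (hp : 1 ≤ p) (hz : zoom c (P.radius c ^ p) z ∈ Metric.closedBall 0 1) :
    z ∈ Metric.closedBall c (P.radius c) :=
  Metric.closedBall_subset_closedBall (P.radius_rpow_le hc hp)
    ((zoom_mem_closedBall_iff (P.radius_rpow_pos hc p)).1 hz)

end DiscPacking

/-! ### The Cantor sets: area and upper bound for Hausdorff measure -/

/-- The `m`-th approximation of the Cantor set built from the packings `P n, P (n + 1), …`, where a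
disc `B(c, r)` of a packing is replaced by its concentric disc of radius `r ^ p`. -/
noncomputable def levelSet (P : ℕ → DiscPacking) (p : ℝ) : ℕ → ℕ → Set ℂ
  | 0, _ => Metric.closedBall 0 1
  | m + 1, n => ⋃ c ∈ (P n).centers, zoom c ((P n).radius c ^ p) ⁻¹' levelSet P p m (n + 1)

/-- The Cantor set built from the packings `P n, P (n + 1), …` with exponent `p`. -/
noncomputable def limitSet (P : ℕ → DiscPacking) (p : ℝ) (n : ℕ) : Set ℂ := ⋂ m, levelSet P p m n

section LevelSets

variable {P : ℕ → DiscPacking} {p : ℝ}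

theorem mem_levelSet_succ {m n : ℕ} {z : ℂ} : z ∈ levelSet P p (m + 1) n ↔
    ∃ c ∈ (P n).centers, zoom c ((P n).radius c ^ p) z ∈ levelSet P p m (n + 1) := by
  simp [levelSet]

theorem levelSet_subset_closedBall (hp : 1 ≤ p) (m n : ℕ) :
    levelSet P p m n ⊆ Metric.closedBall 0 1 := by
  induction m generalizing n with
  | zero => exact subset_rfl
  | succ m ih =>
    intro z hz
    obtain ⟨c, hc, h⟩ := mem_levelSet_succ.1 hz
    exact (P n).closedBall_subset hc ((P n).zoom_rpow_mem_subset hc hp (ih _ h))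

theorem levelSet_succ_subset (hp : 1 ≤ p) (m n : ℕ) :
    levelSet P p (m + 1) n ⊆ levelSet P p m n := by
  induction m generalizing n with
  | zero => exact levelSet_subset_closedBall hp 1 n
  | succ m ih =>
    intro z hz
    obtain ⟨c, hc, h⟩ := mem_levelSet_succ.1 hz
    exact mem_levelSet_succ.2 ⟨c, hc, ih _ h⟩

theorem antitone_levelSet (hp : 1 ≤ p) (n : ℕ) : Antitone fun m => levelSet P p m n :=
  antitone_nat_of_succ_le fun m => levelSet_succ_subset hp m n

theorem isClosed_levelSet (m n : ℕ) : IsClosed (levelSet P p m n) := by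
  induction m generalizing n with
  | zero => exact Metric.isClosed_closedBall
  | succ m ih =>
    exact isClosed_biUnion_finset fun c _ => (ih (n + 1)).preimage (continuous_zoom _ _)

theorem limitSet_subset_levelSet (m n : ℕ) : limitSet P p n ⊆ levelSet P p m n :=
  Set.iInter_subset _ m

theorem isCompact_limitSet (n : ℕ) : IsCompact (limitSet P p n) :=
  (isCompact_closedBall (0 : ℂ) 1).of_isClosed_subset
    (isClosed_iInter fun m => isClosed_levelSet m n) (limitSet_subset_levelSet 0 n)

/-- By disjointness, the disc of the first generation containing z is the same for every depth m. -/
theorem exists_zoom_mem_limitSet (hp : 1 ≤ p) {n : ℕ} {z : ℂ} (hz : z ∈ limitSet P p n) :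
    ∃ c ∈ (P n).centers, zoom c ((P n).radius c ^ p) z ∈ limitSet P p (n + 1) := by
  have hz' : ∀ m, z ∈ levelSet P p m n := fun m => limitSet_subset_levelSet m n hz
  obtain ⟨c, hc, h⟩ := mem_levelSet_succ.1 (hz' 1)
  refine ⟨c, hc, Set.mem_iInter.2 fun m => ?_⟩
  obtain ⟨c', hc', h'⟩ := mem_levelSet_succ.1 (hz' (m + 1))
  have hcc : c = c' := (P n).eq_of_mem_closedBall hc hc'
    ((P n).zoom_rpow_mem_subset hc hp h)
    ((P n).zoom_rpow_mem_subset hc' hp (levelSet_subset_closedBall hp _ _ h'))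
  rwa [hcc]

/-- Since r^p ≤ r/2, each generation multiplies area by at most the sum of r²/4, which is at most
1/4. -/
theorem volume_levelSet_le (hp : 2 ≤ p) (m n : ℕ) :
    volume (levelSet P p m n) ≤ ENNReal.ofReal (Real.pi * (1 / 4) ^ m) := by
  induction m generalizing n with
  | zero => simpa [levelSet] using (volume_closedBall_complex 0 zero_le_one).le
  | succ m ih =>
    calc volume (levelSet P p (m + 1) n)
        ≤ ∑ c ∈ (P n).centers, volume (zoom c ((P n).radius c ^ p) ⁻¹' levelSet P p m (n + 1)) :=
          measure_biUnion_finset_le _ _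
      _ ≤ ∑ c ∈ (P n).centers, ENNReal.ofReal ((P n).radius c ^ 2 / 4 *
            (Real.pi * (1 / 4) ^ m)) := by
          refine Finset.sum_le_sum fun c hc => ?_
          rw [volume_zoom_preimage c ((P n).radius_rpow_pos hc p), ENNReal.ofReal_mul (by positivity)]
          refine mul_le_mul' (ENNReal.ofReal_le_ofReal ?_) (ih _)
          have h1 := (P n).radius_rpow_le_radius_div_two hc hp
          have h2 := (P n).radius_rpow_pos hc p
          nlinarith
      _ = ENNReal.ofReal ((∑ c ∈ (P n).centers, (P n).radius c ^ 2) * (1 / 4) *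
            (Real.pi * (1 / 4) ^ m)) := by
          rw [← ENNReal.ofReal_sum_of_nonneg fun c _ => by positivity, ← Finset.sum_mul,
            ← Finset.sum_div]
          ring_nf
      _ ≤ _ := by
          refine ENNReal.ofReal_le_ofReal ?_
          have h := (P n).sum_sq_le_one
          have h0 : (0 : ℝ) ≤ Real.pi * (1 / 4) ^ m := by positivity
          rw [pow_succ]
          nlinarith

theorem volume_levelSet_one_succ (m n : ℕ) :
    volume (levelSet P 1 (m + 1) n) =
      ENNReal.ofReal (∑ c ∈ (P n).centers, (P n).radius c ^ 2) *
        volume (levelSet P 1 m (n + 1)) := by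
  have h : volume (levelSet P 1 (m + 1) n) =
      ∑ c ∈ (P n).centers, volume (zoom c ((P n).radius c ^ (1 : ℝ)) ⁻¹' levelSet P 1 m (n + 1)) := by
    refine measure_biUnion_finset ?_ fun c _ =>
      ((isClosed_levelSet m (n + 1)).preimage (continuous_zoom _ _)).measurableSet
    intro c hc c' hc' hne
    refine Set.disjoint_left.2 fun z hz hz' => hne ?_
    exact (P n).eq_of_mem_closedBall hc hc'
      ((P n).zoom_rpow_mem_subset hc le_rfl (levelSet_subset_closedBall le_rfl _ _ hz))
      ((P n).zoom_rpow_mem_subset hc' le_rfl (levelSet_subset_closedBall le_rfl _ _ hz'))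
  rw [h, ENNReal.ofReal_sum_of_nonneg fun c _ => by positivity, Finset.sum_mul]
  refine Finset.sum_congr rfl fun c hc => ?_
  rw [volume_zoom_preimage c ((P n).radius_rpow_pos hc 1), Real.rpow_one]

/-- The sequence `v` encodes a lower bound for the infinite product of the sums of r² in a form
suited to induction with shifting n. -/
theorem le_volume_levelSet_one {v : ℕ → ℝ} (hv1 : ∀ n, v n ≤ 1)
    (hv : ∀ n, v n ≤ (∑ c ∈ (P n).centers, (P n).radius c ^ 2) * v (n + 1)) (m n : ℕ) :
    ENNReal.ofReal (Real.pi * v n) ≤ volume (levelSet P 1 m n) := by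
  induction m generalizing n with
  | zero =>
    simp only [levelSet]
    rw [volume_closedBall_complex 0 zero_le_one]
    refine ENNReal.ofReal_le_ofReal ?_
    have := hv1 n
    nlinarith [Real.pi_pos]
  | succ m ih =>
    rw [volume_levelSet_one_succ]
    refine le_trans ?_ (mul_le_mul_right (ih (n + 1)) _)
    rw [← ENNReal.ofReal_mul (Finset.sum_nonneg fun c _ => by positivity)]
    refine ENNReal.ofReal_le_ofReal ?_
    have := hv n
    nlinarith [Real.pi_pos]

theorem volume_limitSet_one_pos {v : ℕ → ℝ} (hv1 : ∀ n, v n ≤ 1)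
    (hv : ∀ n, v n ≤ (∑ c ∈ (P n).centers, (P n).radius c ^ 2) * v (n + 1)) {n : ℕ}
    (hn : 0 < v n) : 0 < volume (limitSet P 1 n) := by
  have h : Tendsto (fun m => volume (levelSet P 1 m n)) atTop (𝓝 (volume (limitSet P 1 n))) := by
    refine tendsto_measure_iInter_atTop
      (fun m => (isClosed_levelSet m n).measurableSet.nullMeasurableSet)
      (antitone_levelSet le_rfl n) ⟨0, ?_⟩
    simp only [levelSet]
    exact (isCompact_closedBall (0 : ℂ) 1).measure_lt_top.ne
  refine lt_of_lt_of_le ?_ (ge_of_tendsto' h fun m => le_volume_levelSet_one hv1 hv m n)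
  exact ENNReal.ofReal_pos.2 (mul_pos Real.pi_pos hn)

/-- Passing to the next generation multiplies the 2/p-sum by the sum of (r^p)^(2/p) = r², which is
at most 1. -/
theorem exists_cover_levelSet (hp : 1 ≤ p) (m n : ℕ) :
    ∃ (ι : Type) (_ : Fintype ι) (b : ι → ℂ) (ρ : ι → ℝ), (∀ i, 0 ≤ ρ i) ∧
      (∀ i, ρ i ≤ (1 / 2) ^ m) ∧ levelSet P p m n ⊆ ⋃ i, Metric.closedBall (b i) (ρ i) ∧
      ∑ i, ρ i ^ (2 / p) ≤ 1 := by
  induction m generalizing n with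
  | zero =>
    refine ⟨Unit, inferInstance, fun _ => 0, fun _ => 1, by simp, by simp, ?_, by simp⟩
    exact Set.subset_iUnion (fun _ : Unit => Metric.closedBall (0 : ℂ) 1) ()
  | succ m ih =>
    obtain ⟨ι, _, b, ρ, h0, hle, hcov, hsum⟩ := ih (n + 1)
    refine ⟨(P n).centers × ι, inferInstance, fun i => i.1 + ((P n).radius i.1 ^ p) • b i.2,
      fun i => (P n).radius i.1 ^ p * ρ i.2, ?_, ?_, ?_, ?_⟩
    · exact fun i => mul_nonneg ((P n).radius_rpow_pos i.1.2 p).le (h0 _)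
    · intro i
      rw [pow_succ']
      exact mul_le_mul ((P n).radius_rpow_le_half i.1.2 hp) (hle _) (h0 _) (by norm_num)
    · intro z hz
      obtain ⟨c, hc, h⟩ := mem_levelSet_succ.1 hz
      obtain ⟨i, hi⟩ := Set.mem_iUnion.1 (hcov h)
      refine Set.mem_iUnion.2 ⟨(⟨c, hc⟩, i), ?_⟩
      have hr := (P n).radius_rpow_pos hc p
      rw [mem_closedBall_iff_norm] at hi ⊢
      have : z - (c + ((P n).radius c ^ p) • b i) =
          ((P n).radius c ^ p) • (zoom c ((P n).radius c ^ p) z - b i) := by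
        rw [smul_sub, zoom_smul_sub hr.ne']; ring
      simp only
      rw [this, norm_smul, Real.norm_of_nonneg hr.le]
      exact mul_le_mul_of_nonneg_left hi hr.le
    · rw [Fintype.sum_prod_type]
      have : ∀ c : (P n).centers, ∑ i, ((P n).radius c ^ p * ρ i) ^ (2 / p) =
          (P n).radius c ^ 2 * ∑ i, ρ i ^ (2 / p) := by
        intro c
        rw [Finset.mul_sum]
        refine Finset.sum_congr rfl fun i _ => ?_
        rw [Real.mul_rpow ((P n).radius_rpow_pos c.2 p).le (h0 _),
          ← Real.rpow_mul ((P n).radius_pos c c.2).le, mul_div_cancel₀ _ (by linarith),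
          Real.rpow_two]
      simp only [this]
      rw [← Finset.sum_mul, Finset.sum_coe_sort (P n).centers fun c => (P n).radius c ^ 2]
      exact mul_le_one₀ (P n).sum_sq_le_one (Finset.sum_nonneg fun i _ => Real.rpow_nonneg (h0 i) _)
        hsum

theorem hausdorffMeasure_limitSet_lt_top (hp : 1 ≤ p) (n : ℕ) :
    Measure.hausdorffMeasure (2 / p) (limitSet P p n) < ⊤ := by
  choose ι hι b ρ h0 hle hcov hsum using fun m => exists_cover_levelSet (P := P) hp m n
  have hp0 : 0 ≤ 2 / p := by positivity
  have hdiam : ∀ m (i : ι m), Metric.ediam (Metric.closedBall (b m i) (ρ m i)) ≤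
      ENNReal.ofReal (2 * ρ m i) := by
    intro m i
    rw [ENNReal.ofReal_mul zero_le_two, ENNReal.ofReal_ofNat, ← Metric.closedEBall_ofReal (h0 m i)]
    exact Metric.ediam_closedEBall_le
  have key := Measure.hausdorffMeasure_le_liminf_sum (2 / p) (limitSet P p n) (l := atTop)
    (fun m => ENNReal.ofReal (2 * (1 / 2) ^ m)) (by
      rw [← ENNReal.ofReal_zero]
      refine ENNReal.tendsto_ofReal ?_
      simpa using (tendsto_pow_atTop_nhds_zero_of_lt_one (r := (1 / 2 : ℝ)) (by norm_num)
        (by norm_num)).const_mul 2)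
    (fun m i => Metric.closedBall (b m i) (ρ m i))
    (Eventually.of_forall fun m i => (hdiam m i).trans
      (ENNReal.ofReal_le_ofReal (by linarith [hle m i])))
    (Eventually.of_forall fun m => (limitSet_subset_levelSet m n).trans (hcov m))
  refine key.trans_lt (lt_of_le_of_lt (b := ENNReal.ofReal (2 ^ (2 / p))) ?_ ENNReal.ofReal_lt_top)
  refine liminf_le_of_le (by isBoundedDefault) fun a ha => ?_
  obtain ⟨m, hm⟩ := ha.exists
  refine hm.trans ?_
  calc ∑ i, Metric.ediam (Metric.closedBall (b m i) (ρ m i)) ^ (2 / p)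
      ≤ ∑ i, ENNReal.ofReal (2 ^ (2 / p) * ρ m i ^ (2 / p)) := by
        refine Finset.sum_le_sum fun i _ => ?_
        refine (ENNReal.rpow_le_rpow (hdiam m i) hp0).trans_eq ?_
        rw [ENNReal.ofReal_rpow_of_nonneg (by linarith [h0 m i]) hp0,
          Real.mul_rpow zero_le_two (h0 m i)]
    _ = ENNReal.ofReal (2 ^ (2 / p) * ∑ i, ρ m i ^ (2 / p)) := by
        rw [Finset.mul_sum, ENNReal.ofReal_sum_of_nonneg]
        exact fun i _ => mul_nonneg (by positivity) (Real.rpow_nonneg (h0 m i) _)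
    _ ≤ _ := by
        refine ENNReal.ofReal_le_ofReal (mul_le_of_le_one_right (by positivity) (hsum m))

end LevelSets

/-! ### Mass distribution and lower bound for Hausdorff measure -/

theorem exists_limit_of_geometric {F : ℕ → ℕ → ℂ → ℂ}
    (h : ∀ m n z, ‖F (m + 1) n z - F m n z‖ ≤ 2 * (1 / 2) ^ m) :
    ∃ G : ℕ → ℂ → ℂ, ∀ m n z, ‖F m n z - G n z‖ ≤ 4 * (1 / 2) ^ m := by
  have h' : ∀ n z m, dist (F m n z) (F (m + 1) n z) ≤ 4 / 2 / 2 ^ m := by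
    intro n z m
    rw [dist_comm, dist_eq_norm]
    refine (h m n z).trans_eq ?_
    rw [one_div, inv_pow]; ring
  have hlim : ∀ n z, ∃ w, Tendsto (fun m => F m n z) atTop (𝓝 w) := fun n z =>
    cauchySeq_tendsto_of_complete (cauchySeq_of_le_geometric_two (h' n z))
  choose G hG using hlim
  refine ⟨G, fun m n z => ?_⟩
  rw [← dist_eq_norm]
  refine (dist_le_of_le_geometric_two_of_tendsto (h' n z) (hG n z) m).trans_eq ?_
  rw [one_div, inv_pow]; ring

theorem tendsto_of_norm_sub_le_geometric {F : ℕ → ℂ} {w : ℂ}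
    (h : ∀ m, ‖F m - w‖ ≤ 4 * (1 / 2) ^ m) : Tendsto F atTop (𝓝 w) := by
  rw [tendsto_iff_norm_sub_tendsto_zero]
  refine squeeze_zero (fun _ => norm_nonneg _) h ?_
  simpa using (tendsto_pow_atTop_nhds_zero_of_lt_one (r := (1 / 2 : ℝ)) (by norm_num)
    (by norm_num)).const_mul 4

/-- On each disc `B(c, r)` of the packing, transport `g` by the similarities onto `B(c, r)` in the
source and onto `B(c, r ^ p)` in the target. -/
noncomputable def DiscPacking.collapse (P : DiscPacking) (p : ℝ) (g : ℂ → ℂ) (z : ℂ) : ℂ :=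
  z + ∑ c ∈ P.centers, (Metric.closedBall c (P.radius c)).indicator
    (fun z => c + (P.radius c ^ p) • g (zoom c (P.radius c) z) - z) z

/-- Iterated collapsing maps, taking `levelSet P 1 m n` to `levelSet P p m n`. -/
noncomputable def collapseIter (P : ℕ → DiscPacking) (p : ℝ) : ℕ → ℕ → ℂ → ℂ
  | 0, _ => id
  | m + 1, n => (P n).collapse p (collapseIter P p m (n + 1))

section Collapse

variable {p : ℝ}

theorem DiscPacking.collapse_of_mem (P : DiscPacking) (g : ℂ → ℂ) {c z : ℂ}
    (hc : c ∈ P.centers) (hz : z ∈ Metric.closedBall c (P.radius c)) :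
    P.collapse p g z = c + (P.radius c ^ p) • g (zoom c (P.radius c) z) := by
  rw [DiscPacking.collapse, P.sum_eq_of_mem_closedBall hc hz fun c' _ h' =>
    Set.indicator_of_notMem h' _, Set.indicator_of_mem hz]
  ring

theorem DiscPacking.collapse_of_notMem (P : DiscPacking) (g : ℂ → ℂ) {z : ℂ}
    (hz : ∀ c ∈ P.centers, z ∉ Metric.closedBall c (P.radius c)) : P.collapse p g z = z := by
  rw [DiscPacking.collapse, Finset.sum_eq_zero fun c hc => Set.indicator_of_notMem (hz c hc) _,
    add_zero]

theorem DiscPacking.measurable_collapse (P : DiscPacking) {g : ℂ → ℂ} (hg : Measurable g) :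
    Measurable (P.collapse p g) := by
  unfold DiscPacking.collapse
  refine measurable_id.add (Finset.measurable_fun_sum _ fun c _ => ?_)
  refine Measurable.indicator ?_ Metric.isClosed_closedBall.measurableSet
  have := hg.comp (continuous_zoom c (P.radius c)).measurable
  exact ((this.const_smul (P.radius c ^ p)).const_add c).sub measurable_id

theorem DiscPacking.norm_collapse_sub_le (P : DiscPacking) (hp : 1 ≤ p) {g g' : ℂ → ℂ} {C : ℝ}
    (h : ∀ z ∈ Metric.closedBall (0 : ℂ) 1, ‖g z - g' z‖ ≤ C) (hC : 0 ≤ C) (z : ℂ) :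
    ‖P.collapse p g z - P.collapse p g' z‖ ≤ C * (1 / 2) := by
  by_cases hz : ∃ c ∈ P.centers, z ∈ Metric.closedBall c (P.radius c)
  · obtain ⟨c, hc, hz⟩ := hz
    rw [P.collapse_of_mem g hc hz, P.collapse_of_mem g' hc hz, add_sub_add_left_eq_sub,
      ← smul_sub, norm_smul, Real.norm_of_nonneg (P.radius_rpow_pos hc p).le, mul_comm]
    exact mul_le_mul (h _ ((zoom_mem_closedBall_iff (P.radius_pos c hc)).2 hz))
      (P.radius_rpow_le_half hc hp) (P.radius_rpow_pos hc p).le hC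
  · push Not at hz
    rw [P.collapse_of_notMem g hz, P.collapse_of_notMem g' hz, sub_self, norm_zero]
    positivity

variable {P : ℕ → DiscPacking}

theorem measurable_collapseIter (m n : ℕ) : Measurable (collapseIter P p m n) := by
  induction m generalizing n with
  | zero => exact measurable_id
  | succ m ih => exact (P n).measurable_collapse (ih (n + 1))

theorem DiscPacking.add_smul_mem_closedBall (P : DiscPacking) (hp : 1 ≤ p) {c w : ℂ}
    (hc : c ∈ P.centers) (hw : w ∈ Metric.closedBall (0 : ℂ) 1) :
    c + (P.radius c ^ p) • w ∈ Metric.closedBall c (P.radius c) := by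
  refine P.zoom_rpow_mem_subset hc hp ?_
  rwa [zoom_add_smul (P.radius_rpow_pos hc p).ne']

theorem mapsTo_collapseIter (hp : 1 ≤ p) (m n : ℕ) :
    Set.MapsTo (collapseIter P p m n) (Metric.closedBall 0 1) (Metric.closedBall 0 1) := by
  induction m generalizing n with
  | zero => exact Set.mapsTo_id _
  | succ m ih =>
    intro z hz
    simp only [collapseIter]
    by_cases h : ∃ c ∈ (P n).centers, z ∈ Metric.closedBall c ((P n).radius c)
    · obtain ⟨c, hc, h⟩ := h
      rw [(P n).collapse_of_mem _ hc h]
      exact (P n).closedBall_subset hc ((P n).add_smul_mem_closedBall hp hc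
        (ih (n + 1) ((zoom_mem_closedBall_iff ((P n).radius_pos c hc)).2 h)))
    · push Not at h
      rwa [(P n).collapse_of_notMem _ h]

theorem norm_collapseIter_succ_sub_le (hp : 1 ≤ p) (m n : ℕ) (z : ℂ) :
    ‖collapseIter P p (m + 1) n z - collapseIter P p m n z‖ ≤ 2 * (1 / 2) ^ m := by
  induction m generalizing n z with
  | zero =>
    simp only [collapseIter, id_eq, pow_zero, mul_one]
    by_cases h : ∃ c ∈ (P n).centers, z ∈ Metric.closedBall c ((P n).radius c)
    · obtain ⟨c, hc, h⟩ := h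
      have h1 := mapsTo_collapseIter (P := P) hp 1 n ((P n).closedBall_subset hc h)
      have h2 := (P n).closedBall_subset hc h
      rw [mem_closedBall_zero_iff] at h1 h2
      exact (norm_sub_le _ _).trans (by simp only [collapseIter] at h1; linarith)
    · push Not at h
      rw [(P n).collapse_of_notMem _ h, sub_self, norm_zero]; norm_num
  | succ m ih =>
    rw [pow_succ, ← mul_assoc]
    exact (P n).norm_collapse_sub_le hp (fun z _ => ih (n + 1) z) (by positivity) z

/-- `H` transports area from the exponent 1 set to the exponent p set. It need not be continuous:
measurability and the self-similar functional equation suffice. -/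
theorem exists_collapse_limit (P : ℕ → DiscPacking) (hp : 1 ≤ p) :
    ∃ H : ℕ → ℂ → ℂ, (∀ n, Measurable (H n)) ∧
      (∀ n, Set.MapsTo (H n) (Metric.closedBall 0 1) (Metric.closedBall 0 1)) ∧
      ∀ n, ∀ c ∈ (P n).centers, ∀ z ∈ Metric.closedBall c ((P n).radius c),
        H n z = c + ((P n).radius c ^ p) • H (n + 1) (zoom c ((P n).radius c) z) := by
  obtain ⟨H, hH⟩ := exists_limit_of_geometric (norm_collapseIter_succ_sub_le (P := P) hp)
  have hlim : ∀ n z, Tendsto (fun m => collapseIter P p m n z) atTop (𝓝 (H n z)) :=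
    fun n z => tendsto_of_norm_sub_le_geometric fun m => hH m n z
  refine ⟨H, fun n => ?_, fun n z hz => ?_, fun n c hc z hz => ?_⟩
  · exact measurable_of_tendsto_metrizable (fun m => measurable_collapseIter m n)
      (tendsto_pi_nhds.2 (hlim n))
  · exact Metric.isClosed_closedBall.mem_of_tendsto (hlim n z)
      (Eventually.of_forall fun m => mapsTo_collapseIter hp m n hz)
  · refine tendsto_nhds_unique ((hlim n z).comp (tendsto_add_atTop_nat 1)) ?_
    have : ((fun m => collapseIter P p m n z) ∘ fun m => m + 1) = fun m =>
        c + ((P n).radius c ^ p) • collapseIter P p m (n + 1) (zoom c ((P n).radius c) z) :=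
      funext fun m => (P n).collapse_of_mem _ hc hz
    rw [this]
    exact ((hlim _ _).const_smul _).const_add c

/-- Shrinking leaves a gap of at least r/2 + r'/2 between two discs, so if `A` meets two or more
shrunken discs, all the discs it meets have r ≤ 2d. They then lie in a ball of radius 2d + 2d + d =
5d, and disjointness compares areas. -/
theorem DiscPacking.sum_sq_le_of_separated (P : DiscPacking) (hp : 2 ≤ p) {A : Set ℂ} {d : ℝ}
    (hd : 0 ≤ d) (hA : ∀ x ∈ A, ∀ y ∈ A, dist x y ≤ d) {s : Finset ℂ} (hs : s ⊆ P.centers)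
    (hsA : ∀ c ∈ s, ∃ a ∈ A, a ∈ Metric.closedBall c (P.radius c ^ p))
    (hs2 : s.Nontrivial) : ∑ c ∈ s, P.radius c ^ 2 ≤ 25 * d ^ 2 := by
  have hrad : ∀ c ∈ s, P.radius c ≤ 2 * d := by
    intro c hc
    obtain ⟨c', hc', hne⟩ := hs2.exists_ne c
    obtain ⟨a, haA, ha⟩ := hsA c hc
    obtain ⟨a', haA', ha'⟩ := hsA c' hc'
    have h1 := P.disjoint c' (hs hc') c (hs hc) hne
    have h2 := P.radius_rpow_le_radius_div_two (hs hc) hp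
    have h3 := P.radius_rpow_le_radius_div_two (hs hc') hp
    have h4 := P.radius_pos c' (hs hc')
    have h5 := hA a haA a' haA'
    rw [Metric.mem_closedBall] at ha ha'
    have h6 := dist_triangle4 c' a' a c
    rw [dist_comm c' a', dist_comm a' a] at h6
    linarith
  obtain ⟨c₀, hc₀⟩ := hs2.nonempty
  obtain ⟨x₀, hx₀, -⟩ := hsA c₀ hc₀
  have := P.sum_sq_le_of_subset hs (x := x₀) (ρ := 5 * d) (by positivity) fun c hc => by
    refine Metric.closedBall_subset_closedBall' ?_
    obtain ⟨a, haA, ha⟩ := hsA c hc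
    rw [Metric.mem_closedBall] at ha
    have h1 := hrad c hc
    have h2 := P.radius_rpow_le (hs hc) (by linarith : 1 ≤ p)
    have h3 := dist_triangle c a x₀
    have h4 := hA a haA x₀ hx₀
    rw [dist_comm c a] at h3
    linarith
  linarith

/-- The mass of a set is controlled by the power `2 / p` of its diameter. -/
theorem volume_inter_preimage_le (hp : 2 ≤ p) {H : ℕ → ℂ → ℂ}
    (hmaps : ∀ n, Set.MapsTo (H n) (Metric.closedBall 0 1) (Metric.closedBall 0 1))
    (hH : ∀ n, ∀ c ∈ (P n).centers, ∀ z ∈ Metric.closedBall c ((P n).radius c),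
        H n z = c + ((P n).radius c ^ p) • H (n + 1) (zoom c ((P n).radius c) z))
    (m n : ℕ) (A : Set ℂ) {d : ℝ} (hd : 0 ≤ d) (hA : ∀ x ∈ A, ∀ y ∈ A, dist x y ≤ d) :
    volume (limitSet P 1 n ∩ H n ⁻¹' A) ≤
      ENNReal.ofReal (max (25 * Real.pi * d ^ (2 / p)) (Real.pi * (1 / 4) ^ m)) := by
  classical
  have hbase : ∀ n A, volume (limitSet P 1 n ∩ H n ⁻¹' A) ≤ ENNReal.ofReal Real.pi := by
    intro n A
    refine (measure_mono (Set.inter_subset_left.trans (limitSet_subset_levelSet 0 n))).trans_eq ?_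
    simp only [levelSet]
    rw [volume_closedBall_complex 0 zero_le_one]; norm_num
  -- The second entry of the maximum is the cost of stopping at depth m, where only the trivial area
  -- bound π is used; it disappears as m → ∞.
  induction m generalizing n A d with
  | zero =>
    refine (hbase n A).trans (ENNReal.ofReal_le_ofReal ?_)
    simp
  | succ m ih =>
    set s := (P n).centers.filter fun c => ∃ a ∈ A, a ∈ Metric.closedBall c ((P n).radius c ^ p)
      with hs
    have hsub : s ⊆ (P n).centers := Finset.filter_subset _ _
    have hsA : ∀ c ∈ s, ∃ a ∈ A, a ∈ Metric.closedBall c ((P n).radius c ^ p) :=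
      fun c hc => (Finset.mem_filter.1 hc).2
    have hcov : limitSet P 1 n ∩ H n ⁻¹' A ⊆ ⋃ c ∈ s, zoom c ((P n).radius c) ⁻¹'
        (limitSet P 1 (n + 1) ∩ H (n + 1) ⁻¹' (zoom c ((P n).radius c ^ p) '' A)) := by
      rintro z ⟨hz, hzA⟩
      obtain ⟨c, hc, h⟩ := exists_zoom_mem_limitSet le_rfl hz
      rw [Real.rpow_one] at h
      have h1 := levelSet_subset_closedBall le_rfl _ _ (limitSet_subset_levelSet 0 _ h)
      have hzc := (zoom_mem_closedBall_iff ((P n).radius_pos c hc)).1 h1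
      have hr := (P n).radius_rpow_pos hc p
      have h2 : zoom c ((P n).radius c ^ p) (H n z) = H (n + 1) (zoom c ((P n).radius c) z) := by
        rw [hH n c hc z hzc, zoom_add_smul hr.ne']
      refine Set.mem_biUnion (Finset.mem_filter.2 ⟨hc, H n z, hzA, ?_⟩) ⟨h, H n z, hzA, h2⟩
      rw [← zoom_mem_closedBall_iff hr, h2]
      exact hmaps _ h1
    have hle : volume (limitSet P 1 n ∩ H n ⁻¹' A) ≤ ∑ c ∈ s,
        ENNReal.ofReal ((P n).radius c ^ 2) * volume (limitSet P 1 (n + 1) ∩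
          H (n + 1) ⁻¹' (zoom c ((P n).radius c ^ p) '' A)) := by
      refine (measure_mono hcov).trans ((measure_biUnion_finset_le _ _).trans_eq ?_)
      refine Finset.sum_congr rfl fun c hc => ?_
      rw [volume_zoom_preimage c ((P n).radius_pos c (hsub hc))]
    rcases s.eq_empty_or_nonempty with hs0 | hs0
    · rw [hs0, Finset.sum_empty] at hle
      exact hle.trans zero_le
    rcases hs0.exists_eq_singleton_or_nontrivial with ⟨c, hc⟩ | hs2
    -- Only one disc is met: zoom into it. The bound is scale invariant, because r² (r^(-p) d)^(2/p)
    -- = d^(2/p).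
    · have hcP : c ∈ (P n).centers := hsub (hc ▸ Finset.mem_singleton_self c)
      rw [hc, Finset.sum_singleton] at hle
      have hr := (P n).radius_rpow_pos hcP p
      have hr0 := (P n).radius_pos c hcP
      refine hle.trans ((mul_le_mul_right (ih (n + 1) (zoom c ((P n).radius c ^ p) '' A)
        (d := ((P n).radius c ^ p)⁻¹ * d) (by positivity) ?_) _).trans ?_)
      · rintro _ ⟨x, hx, rfl⟩ _ ⟨y, hy, rfl⟩
        rw [zoom, zoom, dist_smul₀, dist_sub_right, Real.norm_of_nonneg (by positivity)]
        exact mul_le_mul_of_nonneg_left (hA x hx y hy) (by positivity)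
      · rw [← ENNReal.ofReal_mul (by positivity), mul_max_of_nonneg _ _ (by positivity)]
        refine ENNReal.ofReal_le_ofReal (max_le_max (le_of_eq ?_) ?_)
        · rw [Real.mul_rpow (by positivity) hd, Real.inv_rpow hr.le, ← Real.rpow_mul hr0.le,
            mul_div_cancel₀ _ (by linarith), Real.rpow_two]
          field_simp
        · have h1 := (P n).radius_le c hcP
          have h2 : (P n).radius c ^ 2 ≤ 1 / 4 := by nlinarith
          rw [pow_succ (1 / 4 : ℝ)]
          nlinarith [Real.pi_pos, pow_pos (by norm_num : (0 : ℝ) < 1 / 4) m,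
            mul_pos Real.pi_pos (pow_pos (by norm_num : (0 : ℝ) < 1 / 4) m)]
    -- Several discs are met: the recursion stops, and the total area of these discs is controlled
    -- by separation.
    · refine hle.trans ((Finset.sum_le_sum fun c _ => mul_le_mul_right (hbase _ _) _).trans ?_)
      rw [← Finset.sum_mul, ← ENNReal.ofReal_sum_of_nonneg fun c _ => by positivity,
        ← ENNReal.ofReal_mul (Finset.sum_nonneg fun c _ => by positivity)]
      refine ENNReal.ofReal_le_ofReal (le_max_of_le_left ?_)
      have h1 := (P n).sum_sq_le_of_separated hp hd hA hsub hsA hs2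
      have h2 : ∑ c ∈ s, (P n).radius c ^ 2 ≤ 1 :=
        (Finset.sum_le_sum_of_subset_of_nonneg hsub fun c _ _ => by positivity).trans
          (P n).sum_sq_le_one
      -- For d ≤ 1 this uses d² ≤ d^(2/p), as 2/p ≤ 2; for d ≥ 1 the trivial bound 1 is enough.
      have h3 : ∑ c ∈ s, (P n).radius c ^ 2 ≤ 25 * d ^ (2 / p) := by
        rcases le_total d 1 with hd1 | hd1
        · rcases hd.eq_or_lt with rfl | hd0
          · refine h1.trans ?_
            rw [Real.zero_rpow (by positivity)]; norm_num
          · refine h1.trans (mul_le_mul_of_nonneg_left ?_ (by norm_num))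
            rw [← Real.rpow_two]
            refine Real.rpow_le_rpow_of_exponent_ge hd0 hd1 ?_
            rw [div_le_iff₀ (by linarith)]; linarith
        · have := Real.one_le_rpow hd1 (by positivity : 0 ≤ 2 / p)
          linarith
      nlinarith [Real.pi_pos]

theorem hausdorffMeasure_limitSet_pos (hp : 2 ≤ p) (hvol : 0 < volume (limitSet P 1 0)) :
    0 < Measure.hausdorffMeasure (2 / p) (limitSet P p 0) := by
  obtain ⟨H, hmeas, hmaps, hH⟩ := exists_collapse_limit P (by linarith : 1 ≤ p)
  have hlevel : ∀ m n, Set.MapsTo (H n) (levelSet P 1 m n) (levelSet P p m n) := by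
    intro m
    induction m with
    | zero => exact hmaps
    | succ m ih =>
      intro n z hz
      obtain ⟨c, hc, h⟩ := mem_levelSet_succ.1 hz
      rw [Real.rpow_one] at h
      have hzc := (zoom_mem_closedBall_iff ((P n).radius_pos c hc)).1
        (levelSet_subset_closedBall le_rfl _ _ h)
      refine mem_levelSet_succ.2 ⟨c, hc, ?_⟩
      rw [hH n c hc z hzc, zoom_add_smul ((P n).radius_rpow_pos hc p).ne']
      exact ih _ h
  set μ : Measure ℂ := (volume.restrict (limitSet P 1 0)).map (H 0) with hμ
  have hμapply : ∀ A, MeasurableSet A → μ A = volume (limitSet P 1 0 ∩ H 0 ⁻¹' A) := by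
    intro A hA
    rw [hμ, Measure.map_apply (hmeas 0) hA, Measure.restrict_apply (hmeas 0 hA), Set.inter_comm]
  have hμE : 0 < μ (limitSet P p 0) := by
    rw [hμapply _ (isCompact_limitSet 0).isClosed.measurableSet]
    refine hvol.trans_le (measure_mono fun z hz => ⟨hz, Set.mem_iInter.2 fun m => ?_⟩)
    exact hlevel m 0 (limitSet_subset_levelSet m 0 hz)
  have hp0 : 0 < 2 / p := by positivity
  set C : ℝ≥0∞ := ENNReal.ofReal (25 * Real.pi) with hC
  have hC0 : C ≠ 0 := by rw [hC]; simp [Real.pi_pos]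
  have hC1 : C ≠ ⊤ := ENNReal.ofReal_ne_top
  have hle : C⁻¹ • μ ≤ Measure.hausdorffMeasure (2 / p) := by
    refine Measure.le_hausdorffMeasure _ _ 1 one_pos fun A hA => ?_
    rw [Measure.smul_apply, smul_eq_mul, ENNReal.inv_mul_le_iff hC0 hC1]
    have hfin : Metric.ediam A ≠ ⊤ := ne_top_of_le_ne_top ENNReal.one_ne_top hA
    set d := (Metric.ediam A).toReal with hd
    have hdist : ∀ x ∈ closure A, ∀ y ∈ closure A, dist x y ≤ d := by
      intro x hx y hy
      rw [dist_edist, hd]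
      refine ENNReal.toReal_mono hfin ?_
      rw [← Metric.ediam_closure]
      exact Metric.edist_le_ediam_of_mem hx hy
    have h1 : ∀ m : ℕ, μ A ≤
        ENNReal.ofReal (max (25 * Real.pi * d ^ (2 / p)) (Real.pi * (1 / 4) ^ m)) := fun m => by
      -- `A` may fail to be measurable; its closure is measurable and has the same diameter.
      refine (measure_mono subset_closure).trans ?_
      rw [hμapply _ isClosed_closure.measurableSet]
      exact volume_inter_preimage_le hp hmaps hH m 0 _ ENNReal.toReal_nonneg hdist
    have h2 : Tendsto (fun m : ℕ =>
        ENNReal.ofReal (max (25 * Real.pi * d ^ (2 / p)) (Real.pi * (1 / 4) ^ m))) atTop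
        (𝓝 (ENNReal.ofReal (max (25 * Real.pi * d ^ (2 / p)) (Real.pi * 0)))) :=
      ENNReal.tendsto_ofReal (tendsto_const_nhds.max
        ((tendsto_pow_atTop_nhds_zero_of_lt_one (by norm_num) (by norm_num)).const_mul _))
    refine (ge_of_tendsto' h2 h1).trans_eq ?_
    have hd0 : 0 ≤ d := ENNReal.toReal_nonneg
    rw [mul_zero, max_eq_left (by positivity), ENNReal.ofReal_mul (by positivity),
      ← ENNReal.ofReal_rpow_of_nonneg hd0 hp0.le, hd, ENNReal.ofReal_toReal hfin]
  refine lt_of_lt_of_le ?_ (hle _)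
  rw [Measure.smul_apply, smul_eq_mul]
  exact ENNReal.mul_pos (ENNReal.inv_ne_zero.2 hC1) hμE.ne'

end Collapse

/-! ### Radial stretchings -/

/-- The radial map `w ↦ |w| ^ β w` on the annulus `a ≤ |w| ≤ 1`, extended linearly inside and
outside the annulus. -/
noncomputable def radialStretch (a β : ℝ) (w : ℂ) : ℂ := (min (max ‖w‖ a) 1) ^ β • w

section RadialStretch

variable {a β : ℝ}

theorem radialStretch_of_one_le (β : ℝ) {w : ℂ} (hw : 1 ≤ ‖w‖) : radialStretch a β w = w := by
  rw [radialStretch, min_eq_right (le_max_of_le_left hw), Real.one_rpow, one_smul]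

theorem radialStretch_of_le (ha1 : a ≤ 1) {w : ℂ} (hw : ‖w‖ ≤ a) :
    radialStretch a β w = a ^ β • w := by
  rw [radialStretch, max_eq_right hw, min_eq_left ha1]

theorem radialStretch_of_mem {w : ℂ} (hw : a ≤ ‖w‖) (hw1 : ‖w‖ ≤ 1) :
    radialStretch a β w = ‖w‖ ^ β • w := by
  rw [radialStretch, max_eq_left hw, min_eq_left hw1]

/-- The clamped norm stays in [a, 1], away from 0, where t^β is Lipschitz. The constant is
irrelevant: it serves only to make each finite iterate Lipschitz. -/
theorem exists_lipschitzWith_radialStretch (ha : 0 < a) (ha1 : a ≤ 1) (β : ℝ) :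
    ∃ C : ℝ≥0, LipschitzWith C (radialStretch a β) := by
  obtain ⟨L, hL⟩ : ∃ L : ℝ≥0, LipschitzOnWith L (fun t : ℝ => t ^ β) (Set.Icc a 1) := by
    refine ContDiffOn.exists_lipschitzOnWith (n := 1) ?_ one_ne_zero (convex_Icc a 1) isCompact_Icc
    exact fun t ht => (Real.contDiffAt_rpow_const_of_ne (ha.trans_le ht.1).ne').contDiffWithinAt
  set k : ℝ → ℝ := fun t => min (max t a) 1 with hk
  have hkmem : ∀ t, k t ∈ Set.Icc a 1 := fun t => ⟨le_min (le_max_right _ _) ha1, min_le_right _ _⟩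
  have hklip : ∀ s t, |k s - k t| ≤ |s - t| := fun s t =>
    (abs_min_sub_min_le_max _ _ _ _).trans (by
      rw [sub_self, abs_zero, max_eq_left (abs_nonneg _)]
      exact (abs_max_sub_max_le_max _ _ _ _).trans (by
        rw [sub_self, abs_zero, max_eq_left (abs_nonneg _)]))
  have hdiff : ∀ s t, |k s ^ β - k t ^ β| ≤ L * |s - t| := fun s t => by
    have := hL.dist_le_mul _ (hkmem s) _ (hkmem t)
    rw [Real.dist_eq, Real.dist_eq] at this
    exact this.trans (mul_le_mul_of_nonneg_left (hklip s t) L.2)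
  have hbound : ∀ t, |k t ^ β| ≤ 1 + L := fun t => by
    have h1 := hL.dist_le_mul _ (hkmem t) 1 ⟨ha1, le_rfl⟩
    rw [Real.dist_eq, Real.dist_eq, Real.one_rpow] at h1
    have h2 : |k t - 1| ≤ 1 := by
      rw [abs_le]; constructor <;> linarith [(hkmem t).1, (hkmem t).2]
    have h3 := abs_sub_abs_le_abs_sub (k t ^ β) 1
    rw [abs_one] at h3
    have h4 : (L : ℝ) * |k t - 1| ≤ L := mul_le_of_le_one_right L.2 h2
    linarith
  have main : ∀ w w' : ℂ, ‖w'‖ ≤ ‖w‖ →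
      dist (radialStretch a β w) (radialStretch a β w') ≤ (1 + 2 * L : ℝ≥0) * dist w w' := by
    intro w w' h
    rw [dist_eq_norm, dist_eq_norm]
    -- The factor is varied at the point of smaller norm: it changes only if that norm is at most 1,
    -- so the second term stays bounded by L‖w - w'‖.
    have e : radialStretch a β w - radialStretch a β w' =
        k ‖w‖ ^ β • (w - w') + (k ‖w‖ ^ β - k ‖w'‖ ^ β) • w' := by
      simp only [radialStretch, hk]; module
    have h1 : ‖(k ‖w‖ ^ β - k ‖w'‖ ^ β) • w'‖ ≤ L * ‖w - w'‖ := by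
      rw [norm_smul, Real.norm_eq_abs]
      rcases le_total 1 ‖w'‖ with h1 | h1
      · have : k ‖w‖ = k ‖w'‖ := by
          simp only [hk]
          rw [min_eq_right (le_max_of_le_left h1), min_eq_right (le_max_of_le_left (h1.trans h))]
        rw [this, sub_self, abs_zero, zero_mul]; positivity
      · refine (mul_le_of_le_one_right (abs_nonneg _) h1).trans ((hdiff _ _).trans ?_)
        exact mul_le_mul_of_nonneg_left (abs_norm_sub_norm_le _ _) L.2
    have h2 : ‖k ‖w‖ ^ β • (w - w')‖ ≤ (1 + L) * ‖w - w'‖ := by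
      rw [norm_smul, Real.norm_eq_abs]
      exact mul_le_mul_of_nonneg_right (hbound _) (norm_nonneg _)
    rw [e]
    refine (norm_add_le _ _).trans ?_
    push_cast
    linarith
  refine ⟨1 + 2 * L, LipschitzWith.of_dist_le_mul fun w w' => ?_⟩
  rcases le_total ‖w'‖ ‖w‖ with h | h
  · exact main w w' h
  · rw [dist_comm, dist_comm w]; exact main w' w h

end RadialStretch

/-! ### The stretching maps and their uniform limit -/

/-- On each disc `B(c, r)` of the packing: a radial stretching of the annulus
`r ^ p ≤ |z - c| ≤ r` onto `r ^ q ≤ |z - c| ≤ r`, and a copy of `g` from `B(c, r ^ p)` to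
`B(c, r ^ q)`. -/
noncomputable def DiscPacking.stretch (P : DiscPacking) (p q : ℝ) (g : ℂ → ℂ) (z : ℂ) : ℂ :=
  z + ∑ c ∈ P.centers,
    (P.radius c • (radialStretch (P.radius c ^ (p - 1)) ((q - 1) / (p - 1) - 1)
        (zoom c (P.radius c) z) - zoom c (P.radius c) z) +
      P.radius c ^ q • (g (zoom c (P.radius c ^ p) z) - zoom c (P.radius c ^ p) z))

/-- Iterated stretchings, taking `levelSet P p m n` to `levelSet P q m n`. -/
noncomputable def stretchIter (P : ℕ → DiscPacking) (p q : ℝ) : ℕ → ℕ → ℂ → ℂ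
  | 0, _ => id
  | m + 1, n => (P n).stretch p q (stretchIter P p q m (n + 1))

namespace DiscPacking

variable (P : DiscPacking) {p q : ℝ} {g : ℂ → ℂ}

theorem radius_rpow_le_one {c : ℂ} (hc : c ∈ P.centers) (hp : 0 ≤ p) : P.radius c ^ p ≤ 1 :=
  Real.rpow_le_one (P.radius_pos c hc).le (by linarith [P.radius_le c hc]) hp

/-- Both corrections vanish outside their disc, so at most one summand is active at any point. The
additive form gives Lipschitz continuity without gluing. -/
theorem stretch_term_eq_zero (hp : 2 ≤ p) (hg : ∀ z, 1 ≤ ‖z‖ → g z = z) {c z : ℂ}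
    (hc : c ∈ P.centers) (hz : P.radius c ≤ ‖z - c‖) :
    P.radius c • (radialStretch (P.radius c ^ (p - 1)) ((q - 1) / (p - 1) - 1)
        (zoom c (P.radius c) z) - zoom c (P.radius c) z) +
      P.radius c ^ q • (g (zoom c (P.radius c ^ p) z) - zoom c (P.radius c ^ p) z) = 0 := by
  have hr := P.radius_pos c hc
  have hrp := P.radius_rpow_pos hc p
  have h1 : 1 ≤ ‖zoom c (P.radius c) z‖ := by rwa [norm_zoom hr, one_le_div hr]
  have h2 : 1 ≤ ‖zoom c (P.radius c ^ p) z‖ := by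
    rw [norm_zoom hrp, one_le_div hrp]
    exact (P.radius_rpow_le hc (by linarith)).trans hz
  rw [radialStretch_of_one_le _ h1, hg _ h2, sub_self, sub_self, smul_zero, smul_zero, add_zero]

theorem stretch_of_outside (hp : 2 ≤ p) (hg : ∀ z, 1 ≤ ‖z‖ → g z = z) {z : ℂ}
    (hz : ∀ c ∈ P.centers, P.radius c ≤ ‖z - c‖) : P.stretch p q g z = z := by
  rw [stretch, Finset.sum_eq_zero fun c hc => P.stretch_term_eq_zero hp hg hc (hz c hc), add_zero]

theorem stretch_of_mem (hp : 2 ≤ p) (hg : ∀ z, 1 ≤ ‖z‖ → g z = z) {c z : ℂ}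
    (hc : c ∈ P.centers) (hz : ‖z - c‖ ≤ P.radius c) :
    P.stretch p q g z = c + (P.radius c • radialStretch (P.radius c ^ (p - 1))
      ((q - 1) / (p - 1) - 1) (zoom c (P.radius c) z) +
      P.radius c ^ q • (g (zoom c (P.radius c ^ p) z) - zoom c (P.radius c ^ p) z)) := by
  rw [stretch, P.sum_eq_of_mem_closedBall hc (mem_closedBall_iff_norm.2 hz)]
  · rw [smul_sub _ (radialStretch _ _ _), zoom_smul_sub (P.radius_pos c hc).ne']
    ring
  · intro c' hc' hz'
    rw [mem_closedBall_iff_norm, not_le] at hz'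
    exact P.stretch_term_eq_zero hp hg hc' hz'.le

theorem stretch_of_mem_annulus (hp : 2 ≤ p) (hg : ∀ z, 1 ≤ ‖z‖ → g z = z) {c z : ℂ}
    (hc : c ∈ P.centers) (hz : P.radius c ^ p ≤ ‖z - c‖) (hz' : ‖z - c‖ ≤ P.radius c) :
    P.stretch p q g z = c + (‖z - c‖ / P.radius c) ^ ((q - 1) / (p - 1) - 1) • (z - c) := by
  have hr := P.radius_pos c hc
  have hrp := P.radius_rpow_pos hc p
  have h2 : 1 ≤ ‖zoom c (P.radius c ^ p) z‖ := by rwa [norm_zoom hrp, one_le_div hrp]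
  rw [P.stretch_of_mem hp hg hc hz', hg _ h2, sub_self, smul_zero, add_zero, radialStretch_of_mem,
    smul_comm, zoom_smul_sub hr.ne', norm_zoom hr]
  · rw [norm_zoom hr, Real.rpow_sub_one hr.ne']
    exact div_le_div_of_nonneg_right hz hr.le
  · rwa [norm_zoom hr, div_le_one hr]

/-- Here the radial map is multiplication by r^(q-p), so its contribution r^q · `zoom c (r ^ p) z`
cancels the subtracted zoom. -/
theorem stretch_of_mem_inner (hp : 2 ≤ p) (hg : ∀ z, 1 ≤ ‖z‖ → g z = z) {c z : ℂ}
    (hc : c ∈ P.centers) (hz : ‖z - c‖ ≤ P.radius c ^ p) :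
    P.stretch p q g z = c + P.radius c ^ q • g (zoom c (P.radius c ^ p) z) := by
  have hr := P.radius_pos c hc
  have hrp := P.radius_rpow_pos hc p
  rw [P.stretch_of_mem hp hg hc (hz.trans (P.radius_rpow_le hc (by linarith))),
    radialStretch_of_le (P.radius_rpow_le_one hc (by linarith))]
  · have h1 : P.radius c • (P.radius c ^ (p - 1)) ^ ((q - 1) / (p - 1) - 1) •
        zoom c (P.radius c) z = P.radius c ^ q • zoom c (P.radius c ^ p) z := by
      have e : (p - 1) * ((q - 1) / (p - 1) - 1) = q - p := by
        rw [mul_sub, mul_div_cancel₀ _ (by linarith : p - 1 ≠ 0)]; ring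
      rw [smul_comm, zoom_smul_sub hr.ne', ← Real.rpow_mul hr.le, e, Real.rpow_sub hr, zoom,
        smul_smul, div_eq_mul_inv]
    rw [h1, smul_sub]
    ring
  · rw [norm_zoom hr, Real.rpow_sub_one hr.ne']
    exact div_le_div_of_nonneg_right hz hr.le

/-- Exchanging `p` and `q` inverts the radial exponent κ = (q-1)/(p-1) on annuli and the
similarities on inner discs. -/
theorem stretch_comp_stretch (hp : 2 ≤ p) (hq : 2 ≤ q) (hg : ∀ z, 1 ≤ ‖z‖ → g z = z)
    {h : ℂ → ℂ} (hh : ∀ z, 1 ≤ ‖z‖ → h z = z)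
    (hgm : Set.MapsTo g (Metric.closedBall 0 1) (Metric.closedBall 0 1))
    (hhg : ∀ z, h (g z) = z) (z : ℂ) :
    P.stretch q p h (P.stretch p q g z) = z := by
  by_cases h1 : ∃ c ∈ P.centers, ‖z - c‖ ≤ P.radius c
  · obtain ⟨c, hc, hz⟩ := h1
    have hr := P.radius_pos c hc
    have hrp := P.radius_rpow_pos hc p
    have hrq := P.radius_rpow_pos hc q
    rcases le_total ‖z - c‖ (P.radius c ^ p) with hi | ho
    · have hgz : ‖g (zoom c (P.radius c ^ p) z)‖ ≤ 1 := by
        rw [← mem_closedBall_zero_iff]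
        refine hgm ?_
        rwa [zoom_mem_closedBall_iff hrp, mem_closedBall_iff_norm]
      rw [P.stretch_of_mem_inner hp hg hc hi, P.stretch_of_mem_inner hq hh hc,
        zoom_add_smul hrq.ne', hhg, add_smul_zoom hrp.ne']
      rw [add_sub_cancel_left, norm_smul, Real.norm_of_nonneg hrq.le]
      exact mul_le_of_le_one_right hrq.le hgz
    · have ht : 0 < ‖z - c‖ := hrp.trans_le ho
      have ht' : 0 < ‖z - c‖ / P.radius c := div_pos ht hr
      set κ := (q - 1) / (p - 1) with hκ
      have hκ0 : 0 < κ := div_pos (by linarith) (by linarith)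
      have hn : ‖(‖z - c‖ / P.radius c) ^ (κ - 1) • (z - c)‖ / P.radius c =
          (‖z - c‖ / P.radius c) ^ κ := by
        rw [norm_smul, Real.norm_of_nonneg (by positivity), mul_div_assoc,
          ← Real.rpow_add_one ht'.ne', sub_add_cancel]
      rw [P.stretch_of_mem_annulus hp hg hc ho hz, P.stretch_of_mem_annulus hq hh hc,
        add_sub_cancel_left, hn, ← Real.rpow_mul ht'.le, smul_smul, ← Real.rpow_add ht']
      · have e : κ * ((p - 1) / (q - 1) - 1) + (κ - 1) = 0 := by
          rw [hκ]
          have h1 : p - 1 ≠ 0 := by linarith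
          have h2 : q - 1 ≠ 0 := by linarith
          field_simp; ring
        rw [e, Real.rpow_zero, one_smul]; ring
      · rw [add_sub_cancel_left, ← div_le_div_iff_of_pos_right hr, hn, ← Real.rpow_sub_one hr.ne']
        have h1 : P.radius c ^ (q - 1) = (P.radius c ^ (p - 1)) ^ κ := by
          rw [← Real.rpow_mul hr.le, hκ, mul_div_cancel₀ _ (by linarith : p - 1 ≠ 0)]
        rw [h1]
        refine Real.rpow_le_rpow (by positivity) ?_ hκ0.le
        rw [Real.rpow_sub_one hr.ne']
        exact div_le_div_of_nonneg_right ho hr.le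
      · rw [add_sub_cancel_left, ← div_le_one hr, hn]
        exact Real.rpow_le_one ht'.le ((div_le_one hr).2 hz) hκ0.le
  · push Not at h1
    have h2 : ∀ c ∈ P.centers, P.radius c ≤ ‖z - c‖ := fun c hc => (h1 c hc).le
    rw [P.stretch_of_outside hp hg h2, P.stretch_of_outside hq hh h2]

theorem stretch_of_one_le (hp : 2 ≤ p) (hg : ∀ z, 1 ≤ ‖z‖ → g z = z) {z : ℂ} (hz : 1 ≤ ‖z‖) :
    P.stretch p q g z = z := by
  refine P.stretch_of_outside hp hg fun c hc => ?_
  have := norm_sub_norm_le z c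
  linarith [P.norm_add_radius_le c hc]

theorem exists_lipschitzWith_stretch (hp : 2 ≤ p) (hg : ∃ C, LipschitzWith C g) :
    ∃ C, LipschitzWith C (P.stretch p q g) := by
  obtain ⟨C, hC⟩ := hg
  have hzoom : ∀ (c : ℂ) (ρ : ℝ), LipschitzWith ‖ρ⁻¹‖₊ (zoom c ρ) := fun c ρ =>
    LipschitzWith.of_dist_le_mul fun x y => by
      rw [zoom, zoom, dist_smul₀, dist_sub_right, coe_nnnorm]
  have hsum : ∀ (s : Finset ℂ) (f : ℂ → ℂ → ℂ), (∀ c ∈ s, ∃ C, LipschitzWith C (f c)) →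
      ∃ C, LipschitzWith C fun z => ∑ c ∈ s, f c z := by
    classical
    intro s f
    induction s using Finset.induction_on with
    | empty => exact fun _ => ⟨0, by simp⟩
    | insert c s hc ih =>
      intro h
      obtain ⟨C₁, h₁⟩ := h c (Finset.mem_insert_self c s)
      obtain ⟨C₂, h₂⟩ := ih fun c' hc' => h c' (Finset.mem_insert_of_mem hc')
      simp only [Finset.sum_insert hc]
      exact ⟨C₁ + C₂, h₁.add h₂⟩
  obtain ⟨C', hC'⟩ := hsum P.centers (fun c z =>
    (P.radius c • (radialStretch (P.radius c ^ (p - 1)) ((q - 1) / (p - 1) - 1)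
        (zoom c (P.radius c) z) - zoom c (P.radius c) z) +
      P.radius c ^ q • (g (zoom c (P.radius c ^ p) z) - zoom c (P.radius c ^ p) z))) fun c hc => by
    obtain ⟨S, hS⟩ := exists_lipschitzWith_radialStretch (P.radius_rpow_pos hc (p - 1))
      (P.radius_rpow_le_one hc (by linarith)) ((q - 1) / (p - 1) - 1)
    exact ⟨_, ((lipschitzWith_smul (P.radius c)).comp ((hS.comp (hzoom _ _)).sub (hzoom _ _))).add
      ((lipschitzWith_smul (P.radius c ^ q)).comp ((hC.comp (hzoom _ _)).sub (hzoom _ _)))⟩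
  exact ⟨1 + C', LipschitzWith.id.add hC'⟩

theorem norm_stretch_sub_le (hp : 2 ≤ p) (hq : 2 ≤ q) {g' : ℂ → ℂ}
    (hg : ∀ z, 1 ≤ ‖z‖ → g z = z) (hg' : ∀ z, 1 ≤ ‖z‖ → g' z = z) {C : ℝ}
    (h : ∀ z, ‖g z - g' z‖ ≤ C) (z : ℂ) :
    ‖P.stretch p q g z - P.stretch p q g' z‖ ≤ C * (1 / 2) := by
  have hC : 0 ≤ C := (norm_nonneg _).trans (h 0)
  by_cases h1 : ∃ c ∈ P.centers, ‖z - c‖ ≤ P.radius c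
  · obtain ⟨c, hc, hz⟩ := h1
    have hrq := P.radius_rpow_pos hc q
    rw [P.stretch_of_mem hp hg hc hz, P.stretch_of_mem hp hg' hc hz, add_sub_add_left_eq_sub,
      add_sub_add_left_eq_sub, ← smul_sub, sub_sub_sub_cancel_right, norm_smul,
      Real.norm_of_nonneg hrq.le, mul_comm]
    exact mul_le_mul (h _) (P.radius_rpow_le_half hc (by linarith)) hrq.le hC
  · push Not at h1
    have h2 : ∀ c ∈ P.centers, P.radius c ≤ ‖z - c‖ := fun c hc => (h1 c hc).le
    rw [P.stretch_of_outside hp hg h2, P.stretch_of_outside hp hg' h2, sub_self, norm_zero]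
    positivity

end DiscPacking

section StretchIter

variable {P : ℕ → DiscPacking} {p q : ℝ}

theorem stretchIter_of_one_le (hp : 2 ≤ p) (m n : ℕ) :
    ∀ z, 1 ≤ ‖z‖ → stretchIter P p q m n z = z := by
  induction m generalizing n with
  | zero => exact fun _ _ => rfl
  | succ m ih => exact fun z hz => (P n).stretch_of_one_le hp (ih (n + 1)) hz

theorem exists_lipschitzWith_stretchIter (hp : 2 ≤ p) (m n : ℕ) :
    ∃ C, LipschitzWith C (stretchIter P p q m n) := by
  induction m generalizing n with
  | zero => exact ⟨1, LipschitzWith.id⟩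
  | succ m ih => exact (P n).exists_lipschitzWith_stretch hp (ih (n + 1))

theorem stretchIter_comp_stretchIter (hp : 2 ≤ p) (hq : 2 ≤ q) (m n : ℕ) (z : ℂ) :
    stretchIter P q p m n (stretchIter P p q m n z) = z := by
  induction m generalizing n z with
  | zero => rfl
  | succ m ih =>
    refine (P n).stretch_comp_stretch hp hq (stretchIter_of_one_le hp m _)
      (stretchIter_of_one_le hq m _) (fun w hw => ?_) (ih (n + 1)) z
    rw [mem_closedBall_zero_iff] at hw ⊢
    -- A point sent outside the disc would be fixed by the inverse, hence equal to its own preimage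
    -- in the disc.
    by_contra hcon
    have h1 := stretchIter_of_one_le (P := P) (q := p) hq m (n + 1) _ (not_le.1 hcon).le
    rw [ih (n + 1) w] at h1
    rw [← h1] at hcon
    exact hcon hw

theorem mapsTo_stretchIter_closedBall (hp : 2 ≤ p) (hq : 2 ≤ q) (m n : ℕ) :
    Set.MapsTo (stretchIter P p q m n) (Metric.closedBall 0 1) (Metric.closedBall 0 1) := by
  intro w hw
  rw [mem_closedBall_zero_iff] at hw ⊢
  by_contra hcon
  have h1 := stretchIter_of_one_le (P := P) (q := p) hq m n _ (not_le.1 hcon).le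
  rw [stretchIter_comp_stretchIter hp hq] at h1
  rw [← h1] at hcon
  exact hcon hw

theorem norm_stretchIter_succ_sub_le (hp : 2 ≤ p) (hq : 2 ≤ q) (m n : ℕ) (z : ℂ) :
    ‖stretchIter P p q (m + 1) n z - stretchIter P p q m n z‖ ≤ 2 * (1 / 2) ^ m := by
  induction m generalizing n z with
  | zero =>
    rw [pow_zero, mul_one]
    rcases le_total 1 ‖z‖ with h | h
    · rw [stretchIter_of_one_le hp _ _ _ h, stretchIter_of_one_le hp _ _ _ h, sub_self, norm_zero]
      norm_num
    · rw [← mem_closedBall_zero_iff] at h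
      have h1 := mapsTo_stretchIter_closedBall (P := P) hp hq 1 n h
      rw [mem_closedBall_zero_iff] at h h1
      refine (norm_sub_le _ _).trans ?_
      simp only [stretchIter, id_eq] at h1 ⊢
      linarith
  | succ m ih =>
    rw [pow_succ, ← mul_assoc]
    exact (P n).norm_stretch_sub_le hp hq (stretchIter_of_one_le hp _ _)
      (stretchIter_of_one_le hp _ _) (ih (n + 1)) z

theorem mapsTo_stretchIter_levelSet (hp : 2 ≤ p) (hq : 2 ≤ q) {m m' : ℕ} (hm : m ≤ m') (n : ℕ) :
    Set.MapsTo (stretchIter P p q m' n) (levelSet P p m n) (levelSet P q m n) := by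
  induction m generalizing n m' with
  | zero => exact mapsTo_stretchIter_closedBall hp hq m' n
  | succ m ih =>
    obtain ⟨m', rfl⟩ : ∃ k, m' = k + 1 := ⟨m' - 1, by omega⟩
    intro z hz
    obtain ⟨c, hc, h⟩ := mem_levelSet_succ.1 hz
    refine mem_levelSet_succ.2 ⟨c, hc, ?_⟩
    have h1 := (zoom_mem_closedBall_iff ((P n).radius_rpow_pos hc p)).1
      (levelSet_subset_closedBall (by linarith) _ _ h)
    rw [stretchIter, (P n).stretch_of_mem_inner hp (stretchIter_of_one_le hp _ _) hc
      (mem_closedBall_iff_norm.1 h1), zoom_add_smul ((P n).radius_rpow_pos hc q).ne']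
    exact ih (by omega) (n + 1) h

/-- Deeper iterates differ only inside the innermost discs; this stabilization makes the limit
locally equal to a finite iterate off the limit set. -/
theorem stretchIter_eq_of_notMem_levelSet (hp : 2 ≤ p) {m m' : ℕ} (hm : m ≤ m') (n : ℕ) {z : ℂ}
    (hz : z ∉ levelSet P p m n) : stretchIter P p q m' n z = stretchIter P p q m n z := by
  induction m generalizing n m' z with
  | zero =>
    simp only [levelSet, mem_closedBall_zero_iff, not_le] at hz
    rw [stretchIter_of_one_le hp _ _ _ hz.le, stretchIter_of_one_le hp _ _ _ hz.le]
  | succ m ih =>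
    obtain ⟨m', rfl⟩ : ∃ k, m' = k + 1 := ⟨m' - 1, by omega⟩
    rw [mem_levelSet_succ] at hz
    push Not at hz
    simp only [stretchIter, DiscPacking.stretch]
    congr 1
    refine Finset.sum_congr rfl fun c hc => ?_
    rw [ih (by omega) (n + 1) (hz c hc)]

/-- The uniform limit of the iterated stretchings, with its basic properties. -/
theorem exists_stretch_limit (P : ℕ → DiscPacking) (hp : 2 ≤ p) (hq : 2 ≤ q) :
    ∃ φ : ℂ → ℂ, IsHomeomorph φ ∧ (∀ z, 1 ≤ ‖z‖ → φ z = z) ∧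
      (∀ m z, ‖stretchIter P p q m 0 z - φ z‖ ≤ 4 * (1 / 2) ^ m) ∧
      (∀ m, ∀ z ∉ levelSet P p m 0, φ z = stretchIter P p q m 0 z) ∧
      (∀ m, Set.MapsTo φ (levelSet P p m 0) (levelSet P q m 0)) ∧
      φ '' limitSet P p 0 = limitSet P q 0 := by
  have key : ∀ p q : ℝ, 2 ≤ p → 2 ≤ q → ∃ φ : ℂ → ℂ, Continuous φ ∧
      (∀ m z, ‖stretchIter P p q m 0 z - φ z‖ ≤ 4 * (1 / 2) ^ m) ∧
      (∀ z, Tendsto (fun m => stretchIter P p q m 0 z) atTop (𝓝 (φ z))) ∧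
      (∀ m, Set.MapsTo φ (levelSet P p m 0) (levelSet P q m 0)) := by
    intro p q hp hq
    obtain ⟨G, hG⟩ := exists_limit_of_geometric (norm_stretchIter_succ_sub_le (P := P) hp hq)
    have hlim : ∀ z, Tendsto (fun m => stretchIter P p q m 0 z) atTop (𝓝 (G 0 z)) :=
      fun z => tendsto_of_norm_sub_le_geometric fun m => hG m 0 z
    have hunif : TendstoUniformly (fun m => stretchIter P p q m 0) (G 0) atTop := by
      rw [Metric.tendstoUniformly_iff]
      intro ε hε
      have h4 : Tendsto (fun m : ℕ => 4 * (1 / 2 : ℝ) ^ m) atTop (𝓝 0) := by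
        simpa using (tendsto_pow_atTop_nhds_zero_of_lt_one (r := (1 / 2 : ℝ)) (by norm_num)
          (by norm_num)).const_mul 4
      filter_upwards [h4.eventually_lt_const hε] with m hm z
      rw [dist_comm, dist_eq_norm]
      exact (hG m 0 z).trans_lt hm
    refine ⟨G 0, hunif.continuous (Frequently.of_forall fun m => ?_), fun m z => hG m 0 z, hlim,
      fun m z hz => ?_⟩
    · exact (exists_lipschitzWith_stretchIter hp m 0).choose_spec.continuous
    · refine (isClosed_levelSet m 0).mem_of_tendsto (hlim z) ?_
      filter_upwards [eventually_ge_atTop m] with k hk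
      exact mapsTo_stretchIter_levelSet hp hq hk 0 hz
  -- Uniform closeness of the inverse iterates to ψ, evaluated at the moving points `stretchIter P p
  -- q m 0 z`, shows that ψ of these points tends to z.
  have hinv : ∀ p q : ℝ, 2 ≤ p → 2 ≤ q → ∀ φ ψ : ℂ → ℂ, Continuous ψ →
      (∀ z, Tendsto (fun m => stretchIter P p q m 0 z) atTop (𝓝 (φ z))) →
      (∀ m z, ‖stretchIter P q p m 0 z - ψ z‖ ≤ 4 * (1 / 2) ^ m) → ∀ z, ψ (φ z) = z := by
    intro p q hp hq φ ψ hψ hφ hψ' z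
    refine tendsto_nhds_unique ((hψ.tendsto (φ z)).comp (hφ z))
      (tendsto_of_norm_sub_le_geometric fun m => ?_)
    have := hψ' m (stretchIter P p q m 0 z)
    rwa [stretchIter_comp_stretchIter hp hq, norm_sub_rev] at this
  obtain ⟨φ, hφc, hφu, hφl, hφm⟩ := key p q hp hq
  obtain ⟨ψ, hψc, hψu, hψl, hψm⟩ := key q p hq hp
  have hψφ := hinv p q hp hq φ ψ hψc hφl hψu
  have hφψ := hinv q p hq hp ψ φ hφc hψl hφu
  refine ⟨φ, ?_, fun z hz => ?_, hφu, fun m z hz => ?_, hφm, ?_⟩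
  · exact (Homeomorph.mk ⟨φ, ψ, hψφ, hφψ⟩ hφc hψc).isHomeomorph
  · refine tendsto_nhds_unique (hφl z) ?_
    simp only [stretchIter_of_one_le hp _ _ _ hz]
    exact tendsto_const_nhds
  · refine tendsto_nhds_unique (hφl z) (tendsto_const_nhds.congr' ?_)
    filter_upwards [eventually_ge_atTop m] with k hk
    exact (stretchIter_eq_of_notMem_levelSet hp hk 0 hz).symm
  · refine Set.Subset.antisymm ?_ fun w hw => ⟨ψ w, ?_, hφψ w⟩
    · rintro _ ⟨z, hz, rfl⟩
      exact Set.mem_iInter.2 fun m => hφm m (Set.mem_iInter.1 hz m)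
    · exact Set.mem_iInter.2 fun m => hψm m (Set.mem_iInter.1 hw m)

end StretchIter

/-! ### Distortion of the derivative -/

/-- The real linear map `v ↦ a v + b v̄` with `|a| + |b| ≤ K (|a| - |b|)`. -/
def IsBeltrami (K : ℝ) (L : ℂ →L[ℝ] ℂ) : Prop :=
  ∃ a b : ℂ, (∀ v, L v = a * v + b * (starRingEnd ℂ) v) ∧ ‖a‖ + ‖b‖ ≤ K * (‖a‖ - ‖b‖)

/-- `g` is differentiable almost everywhere with derivative of distortion at most `K`. -/
def AEBeltrami (K : ℝ) (g : ℂ → ℂ) : Prop :=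
  ∀ᵐ z, DifferentiableAt ℝ g z ∧ IsBeltrami K (fderiv ℝ g z)

section Beltrami

variable {K : ℝ}

theorem IsBeltrami.norm_le_mul_norm {L : ℂ →L[ℝ] ℂ} (hK : 0 ≤ K) (hL : IsBeltrami K L) {u v : ℂ}
    (hu : ‖u‖ = 1) (hv : ‖v‖ = 1) : ‖L u‖ ≤ K * ‖L v‖ := by
  obtain ⟨a, b, hab, h⟩ := hL
  have h1 : ‖L u‖ ≤ ‖a‖ + ‖b‖ := by
    rw [hab]
    refine (norm_add_le _ _).trans ?_
    rw [norm_mul, norm_mul, Complex.norm_conj, hu, mul_one, mul_one]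
  have h2 : ‖a‖ - ‖b‖ ≤ ‖L v‖ := by
    have := norm_sub_norm_le (a * v) (-(b * (starRingEnd ℂ) v))
    rwa [sub_neg_eq_add, norm_neg, norm_mul, norm_mul, Complex.norm_conj, hv, mul_one, mul_one,
      ← hab] at this
  exact h1.trans (h.trans (mul_le_mul_of_nonneg_left h2 hK))

/-- The determinant is |a|² - |b|² and the operator norm is at most |a| + |b|, so the claim is the
defining inequality times |a| + |b|. -/
theorem IsBeltrami.norm_sq_le {L : ℂ →L[ℝ] ℂ} (hK : 0 ≤ K) (hL : IsBeltrami K L) : ‖L‖ ^ 2 ≤ K * |L.det| := by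
  obtain ⟨a, b, hab, h⟩ := hL
  have hdet : L.det = ‖a‖ ^ 2 - ‖b‖ ^ 2 := by
    rw [ContinuousLinearMap.det, ← LinearMap.det_toMatrix Complex.basisOneI, Matrix.det_fin_two]
    simp only [LinearMap.toMatrix_apply, Complex.coe_basisOneI, Complex.coe_basisOneI_repr,
      ContinuousLinearMap.coe_coe, hab, Complex.sq_norm, Complex.normSq_apply]
    simp
    ring
  have hn : ‖L‖ ≤ ‖a‖ + ‖b‖ := by
    refine L.opNorm_le_bound (by positivity) fun v => ?_
    rw [hab]
    refine (norm_add_le _ _).trans_eq ?_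
    rw [norm_mul, norm_mul, Complex.norm_conj]; ring
  calc ‖L‖ ^ 2 ≤ (‖a‖ + ‖b‖) ^ 2 := by gcongr
    _ ≤ K * (‖a‖ - ‖b‖) * (‖a‖ + ‖b‖) := by
      rw [sq]; exact mul_le_mul_of_nonneg_right h (by positivity)
    _ = K * L.det := by rw [hdet]; ring
    _ ≤ K * |L.det| := by
      exact mul_le_mul_of_nonneg_left (le_abs_self _) hK

theorem IsBeltrami.id (hK : 1 ≤ K) : IsBeltrami K (ContinuousLinearMap.id ℝ ℂ) :=
  ⟨1, 0, fun v => by simp, by simpa using hK⟩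

/-- The distortion inequality bounds the squared norm by K times the Jacobian, whose integral is the
image area by injectivity. -/
theorem AEBeltrami.lintegral_enorm_fderiv_sq_le {g : ℂ → ℂ} (hg : AEBeltrami K g) (hK : 0 ≤ K)
    (hinj : Function.Injective g) {S : Set ℂ} (hS : MeasurableSet S) :
    ∫⁻ z in S, ‖fderiv ℝ g z‖ₑ ^ 2 ≤ ENNReal.ofReal K * volume (g '' S) := by
  set T := S ∩ {z | DifferentiableAt ℝ g z} with hT
  have hTm : MeasurableSet T := hS.inter (measurableSet_of_differentiableAt ℝ g)
  have hae : S =ᵐ[volume] T := by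
    filter_upwards [hg] with z hz
    apply propext
    exact ⟨fun h => ⟨h, hz.1⟩, fun h => h.1⟩
  rw [Measure.restrict_congr_set hae]
  calc ∫⁻ z in T, ‖fderiv ℝ g z‖ₑ ^ 2
      ≤ ∫⁻ z in T, ENNReal.ofReal K * ENNReal.ofReal |(fderiv ℝ g z).det| := by
        refine lintegral_mono_ae (ae_restrict_of_ae ?_)
        filter_upwards [hg] with z hz
        rw [← ENNReal.ofReal_mul hK, ← ofReal_norm, ← ENNReal.ofReal_pow (norm_nonneg _)]
        exact ENNReal.ofReal_le_ofReal (hz.2.norm_sq_le hK)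
    _ = ENNReal.ofReal K * volume (g '' T) := by
        rw [lintegral_const_mul' _ _ ENNReal.ofReal_ne_top,
          lintegral_abs_det_fderiv_eq_addHaar_image volume hTm
            (fun z hz => hz.2.hasFDerivAt.hasFDerivWithinAt) hinj.injOn]
    _ ≤ _ := by gcongr; exact Set.inter_subset_left

theorem hasFDerivAt_norm_rpow_smul (β : ℝ) {w : ℂ} (hw : w ≠ 0) :
    ∃ L : ℂ →L[ℝ] ℂ, HasFDerivAt (fun w : ℂ => ‖w‖ ^ β • w) L w ∧ ∀ v, L v =
      (‖w‖ ^ β * (1 + β / 2) : ℝ) * v +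
        ((‖w‖ ^ β * (β / 2) / ‖w‖ ^ 2 : ℝ) * w ^ 2) * (starRingEnd ℂ) v := by
  have hn : 0 < ‖w‖ := norm_pos_iff.2 hw
  have h1 : HasFDerivAt (fun x : ℂ => ‖x‖ ^ 2) (2 • innerSL ℝ w) w :=
    (hasStrictFDerivAt_norm_sq w).hasFDerivAt
  have h2 := (h1.rpow_const (p := β / 2) (Or.inl (by positivity))).smul (hasFDerivAt_id w)
  -- Writing |x|^β through |x|² reduces differentiation to a power of a smooth function, positive
  -- off the origin.
  have e : ∀ x : ℂ, (‖x‖ ^ 2) ^ (β / 2) = ‖x‖ ^ β := fun x => by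
    rw [← Real.rpow_natCast, ← Real.rpow_mul (norm_nonneg _)]
    congr 1; push_cast; ring
  have h3 : (fun w : ℂ => ‖w‖ ^ β • w) = (fun x : ℂ => (‖x‖ ^ 2) ^ (β / 2)) • _root_.id := by
    funext x
    rw [Pi.smul_apply', e]; rfl
  rw [h3]
  refine ⟨_, h2, fun v => ?_⟩
  have e2 : (‖w‖ ^ 2) ^ (β / 2 - 1) = ‖w‖ ^ β / ‖w‖ ^ 2 := by
    rw [Real.rpow_sub_one (by positivity), e]
  have e3 : w * (inner ℝ w v : ℝ) = ((‖w‖ ^ 2 : ℝ) * v + w ^ 2 * (starRingEnd ℂ) v) / 2 := by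
    have h4 : ((inner ℝ w v : ℝ) : ℂ) =
        ((starRingEnd ℂ) w * v + w * (starRingEnd ℂ) v) / 2 := by
      rw [Complex.inner]
      apply Complex.ext <;> simp <;> ring
    have h5 : ((‖w‖ ^ 2 : ℝ) : ℂ) = w * (starRingEnd ℂ) w := by
      rw [Complex.mul_conj, Complex.normSq_eq_norm_sq]
    rw [h4, h5]; ring
  have hn2 : ((‖w‖ : ℝ) : ℂ) ≠ 0 := by exact_mod_cast hn.ne'
  simp only [add_apply, smul_apply,
    ContinuousLinearMap.smulRight_apply, ContinuousLinearMap.coe_id', id_eq, innerSL_apply_apply,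
    e, e2, Complex.real_smul, smul_eq_mul, nsmul_eq_mul]
  push_cast at e3 ⊢
  have e4 : (‖w‖ : ℂ) ^ 2 * ((‖w‖ : ℂ) ^ 2)⁻¹ = 1 := mul_inv_cancel₀ (pow_ne_zero 2 hn2)
  linear_combination (2 * (β / 2) * ((‖w‖ ^ β : ℝ) : ℂ) / (‖w‖ : ℂ) ^ 2) * e3 + ((‖w‖ ^ β : ℝ) : ℂ) * v * (β / 2) * e4

end Beltrami

section StretchDerivative

variable {K : ℝ}

theorem IsBeltrami.smul {L : ℂ →L[ℝ] ℂ} (hL : IsBeltrami K L) {t : ℝ} (ht : 0 ≤ t) :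
    IsBeltrami K (t • L) := by
  obtain ⟨a, b, hab, h⟩ := hL
  refine ⟨t * a, t * b, fun v => ?_, ?_⟩
  · rw [smul_apply, hab, Complex.real_smul]; ring
  · rw [norm_mul, norm_mul, Complex.norm_real, Real.norm_of_nonneg ht]
    nlinarith

/-- With t = |w|^(1/K - 1) one has |a| + |b| = t and |a| - |b| = t/K: distortion exactly K. -/
theorem exists_hasFDerivAt_radial (hK : 1 ≤ K) {w : ℂ} (hw : w ≠ 0) :
    ∃ L : ℂ →L[ℝ] ℂ, HasFDerivAt (fun w : ℂ => ‖w‖ ^ (1 / K - 1) • w) L w ∧ IsBeltrami K L := by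
  obtain ⟨L, hL, h⟩ := hasFDerivAt_norm_rpow_smul (1 / K - 1) hw
  have hK0 : 0 < K := by linarith
  have hn : 0 < ‖w‖ := norm_pos_iff.2 hw
  refine ⟨L, hL, _, _, h, ?_⟩
  set t := ‖w‖ ^ (1 / K - 1) with ht
  have ht0 : 0 < t := Real.rpow_pos_of_pos hn _
  have hK1 : 1 / K ≤ 1 := (div_le_one hK0).2 hK
  have hK2 : 0 < 1 / K := by positivity
  have ha : ‖((t * (1 + (1 / K - 1) / 2) : ℝ) : ℂ)‖ = t * (1 + (1 / K - 1) / 2) := by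
    rw [Complex.norm_real, Real.norm_of_nonneg]
    exact mul_nonneg ht0.le (by linarith)
  have hb : ‖((t * ((1 / K - 1) / 2) / ‖w‖ ^ 2 : ℝ) : ℂ) * w ^ 2‖ = t * ((1 - 1 / K) / 2) := by
    rw [norm_mul, norm_pow, Complex.norm_real, Real.norm_of_nonpos, neg_mul,
      div_mul_cancel₀ _ (by positivity)]
    · ring
    · exact div_nonpos_of_nonpos_of_nonneg
        (mul_nonpos_of_nonneg_of_nonpos ht0.le (by linarith)) (by positivity)
  rw [ha, hb]
  refine le_of_eq ?_
  field_simp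
  ring

theorem hasFDerivAt_zoom (c : ℂ) (ρ : ℝ) (z : ℂ) :
    HasFDerivAt (zoom c ρ) (ρ⁻¹ • ContinuousLinearMap.id ℝ ℂ) z :=
  ((hasFDerivAt_id z).sub_const c).const_smul ρ⁻¹

theorem ae_zoom {c : ℂ} {ρ : ℝ} (hρ : 0 < ρ) {p : ℂ → Prop} (hp : ∀ᵐ z, p z) :
    ∀ᵐ z, p (zoom c ρ z) := by
  rw [ae_iff] at hp ⊢
  have := volume_zoom_preimage c hρ {z | ¬ p z}
  rw [hp, mul_zero] at this
  exact this

theorem ae_norm_sub_ne (c : ℂ) {ρ : ℝ} (hρ : ρ ≠ 0) : ∀ᵐ z : ℂ, ‖z - c‖ ≠ ρ := by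
  have h := Measure.addHaar_sphere_of_ne_zero (volume : Measure ℂ) c hρ
  rw [ae_iff]
  convert h using 2
  ext z
  simp

/-- Off finitely many circles, which are null, the map is locally the identity, a rescaled radial
stretching, or a similar copy of `g`. -/
theorem DiscPacking.aeBeltrami_stretch (P : DiscPacking) (hK : 1 ≤ K) {g : ℂ → ℂ}
    (hg : ∀ z, 1 ≤ ‖z‖ → g z = z) (hgK : AEBeltrami K g) :
    AEBeltrami K (P.stretch (K + 1) 2 g) := by
  have hp : 2 ≤ K + 1 := by linarith
  have hK0 : K ≠ 0 := by linarith
  have h1 : ∀ᵐ z : ℂ, ∀ c ∈ P.centers, ‖z - c‖ ≠ P.radius c :=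
    (Finset.eventually_all _).2 fun c hc => ae_norm_sub_ne c (P.radius_pos c hc).ne'
  have h2 : ∀ᵐ z : ℂ, ∀ c ∈ P.centers, ‖z - c‖ ≠ P.radius c ^ (K + 1) :=
    (Finset.eventually_all _).2 fun c hc => ae_norm_sub_ne c (P.radius_rpow_pos hc _).ne'
  have h3 : ∀ᵐ z : ℂ, ∀ c ∈ P.centers,
      DifferentiableAt ℝ g (zoom c (P.radius c ^ (K + 1)) z) ∧
        IsBeltrami K (fderiv ℝ g (zoom c (P.radius c ^ (K + 1)) z)) :=
    (Finset.eventually_all _).2 fun c hc => ae_zoom (P.radius_rpow_pos hc _) hgK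
  suffices h : ∀ z : ℂ, (∀ c ∈ P.centers, ‖z - c‖ ≠ P.radius c) →
      (∀ c ∈ P.centers, ‖z - c‖ ≠ P.radius c ^ (K + 1)) →
      (∀ c ∈ P.centers, DifferentiableAt ℝ g (zoom c (P.radius c ^ (K + 1)) z) ∧
        IsBeltrami K (fderiv ℝ g (zoom c (P.radius c ^ (K + 1)) z))) →
      ∃ L, HasFDerivAt (P.stretch (K + 1) 2 g) L z ∧ IsBeltrami K L by
    filter_upwards [h1, h2, h3] with z h1 h2 h3
    obtain ⟨L, hL, hLK⟩ := h z h1 h2 h3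
    exact ⟨hL.differentiableAt, hL.fderiv ▸ hLK⟩
  clear h1 h2 h3
  intro z h1 h2 h3
  have hcont : ∀ c : ℂ, Continuous fun z : ℂ => ‖z - c‖ := fun c => by fun_prop
  by_cases hz : ∃ c ∈ P.centers, ‖z - c‖ < P.radius c
  · obtain ⟨c, hc, hz⟩ := hz
    have hr := P.radius_pos c hc
    have hrp := P.radius_rpow_pos hc (K + 1)
    rcases (h2 c hc).lt_or_gt with hi | ho
    · obtain ⟨hd, hB⟩ := h3 c hc
      have hev : P.stretch (K + 1) 2 g =ᶠ[𝓝 z] fun z =>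
          c + P.radius c ^ (2 : ℝ) • g (zoom c (P.radius c ^ (K + 1)) z) := by
        filter_upwards [(hcont c).continuousAt.eventually_lt_const hi] with y hy
        exact P.stretch_of_mem_inner hp hg hc hy.le
      refine ⟨_, ((((hd.hasFDerivAt.comp z (hasFDerivAt_zoom _ _ _)).const_smul
        (P.radius c ^ (2 : ℝ))).const_add c).congr_of_eventuallyEq hev), ?_⟩
      rw [ContinuousLinearMap.comp_smul, ContinuousLinearMap.comp_id]
      exact (hB.smul (by positivity)).smul (by positivity)
    · have hev : P.stretch (K + 1) 2 g =ᶠ[𝓝 z] fun z =>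
          c + (P.radius c ^ (1 / K - 1))⁻¹ • (‖z - c‖ ^ (1 / K - 1) • (z - c)) := by
        filter_upwards [(hcont c).continuousAt.eventually_lt_const hz,
          (hcont c).continuousAt.eventually_const_lt ho] with y hy hy'
        rw [P.stretch_of_mem_annulus hp hg hc hy'.le hy.le, Real.div_rpow (norm_nonneg _) hr.le,
          smul_smul, div_eq_inv_mul]
        norm_num
      have hzc : z - c ≠ 0 := norm_pos_iff.1 (hrp.trans ho)
      obtain ⟨L, hL, hLK⟩ := exists_hasFDerivAt_radial hK hzc
      refine ⟨_, ((((hL.comp z ((hasFDerivAt_id z).sub_const c)).const_smul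
        (P.radius c ^ (1 / K - 1))⁻¹).const_add c).congr_of_eventuallyEq hev), ?_⟩
      rw [ContinuousLinearMap.comp_id]
      exact hLK.smul (by positivity)
  · push Not at hz
    have hev : P.stretch (K + 1) 2 g =ᶠ[𝓝 z] _root_.id := by
      have : ∀ᶠ y in 𝓝 z, ∀ c ∈ P.centers, P.radius c < ‖y - c‖ :=
        (Finset.eventually_all _).2 fun c hc => (hcont c).continuousAt.eventually_const_lt
          ((hz c hc).lt_of_ne (h1 c hc).symm)
      filter_upwards [this] with y hy
      exact P.stretch_of_outside hp hg fun c hc => (hy c hc).le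
    exact ⟨_, (hasFDerivAt_id z).congr_of_eventuallyEq hev, IsBeltrami.id hK⟩

theorem aeBeltrami_stretchIter {P : ℕ → DiscPacking} (hK : 1 ≤ K) (m n : ℕ) :
    AEBeltrami K (stretchIter P (K + 1) 2 m n) := by
  induction m generalizing n with
  | zero =>
    refine Eventually.of_forall fun z => ⟨differentiableAt_id, ?_⟩
    have : fderiv ℝ (stretchIter P (K + 1) 2 0 n) z = ContinuousLinearMap.id ℝ ℂ := fderiv_id
    rw [this]
    exact IsBeltrami.id hK
  | succ m ih =>
    exact (P n).aeBeltrami_stretch hK (stretchIter_of_one_le (by linarith) _ _) (ih (n + 1))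

end StretchDerivative

/-! ### Weak derivatives and quasiconformality of the limit -/

section WeakDerivative

theorem integrable_smul_fderiv_of_lipschitzWith {F : Type*} [NormedAddCommGroup F]
    [NormedSpace ℝ F] [MeasurableSpace F] [BorelSpace F] [SecondCountableTopology F]
    [CompleteSpace F] {f : ℂ → F} {C : ℝ≥0} (hf : LipschitzWith C f) {η : ℂ → ℝ}
    (hη : Continuous η) (hηc : HasCompactSupport η) (v : ℂ) :
    Integrable fun z => η z • fderiv ℝ f z v := by
  refine Integrable.mono' (g := fun z => (C * ‖v‖) * ‖η z‖)
    ((hη.integrable_of_hasCompactSupport hηc).norm.const_mul _) ?_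
    (Eventually.of_forall fun z => ?_)
  · exact hη.aestronglyMeasurable.smul (measurable_fderiv_apply_const ℝ f v).aestronglyMeasurable
  · rw [norm_smul, mul_comm]
    refine mul_le_mul_of_nonneg_right ?_ (norm_nonneg _)
    exact ContinuousLinearMap.le_of_opNorm_le _ (norm_fderiv_le_of_lipschitz ℝ hf) v

/-- Integration by parts for Lipschitz functions. -/
theorem LipschitzWith.integral_fderiv_smul {f : ℂ → ℂ} {C : ℝ≥0} (hf : LipschitzWith C f)
    {η : ℂ → ℝ} (hη : ContDiff ℝ ∞ η) (hηc : HasCompactSupport η) (v : ℂ) :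
    ∫ z, (fderiv ℝ η z v) • f z = - ∫ z, (η z) • (fderiv ℝ f z v) := by
  obtain ⟨D, hD⟩ := ContDiff.lipschitzWith_of_hasCompactSupport hηc hη (by simp)
  have hdη : Continuous fun z => fderiv ℝ η z v :=
    (hη.continuous_fderiv (by simp)).clm_apply continuous_const
  have hi1 : Integrable fun z => (fderiv ℝ η z v) • f z := by
    refine (hdη.smul hf.continuous).integrable_of_hasCompactSupport ?_
    exact (hηc.fderiv_apply ℝ v).smul_right
  have hi2 := integrable_smul_fderiv_of_lipschitzWith hf hη.continuous hηc v
  have key : ∀ ℓ : ℂ →L[ℝ] ℝ,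
      ∫ z, ℓ ((fderiv ℝ η z v) • f z) = - ∫ z, ℓ ((η z) • (fderiv ℝ f z v)) := by
    intro ℓ
    have h := (ℓ.lipschitz.comp hf).integral_lineDeriv_mul_eq (μ := volume) hD hηc v
    have h1 : ∫ z, ℓ ((η z) • (fderiv ℝ f z v)) = ∫ z, lineDeriv ℝ (ℓ ∘ f) z v * η z := by
      refine integral_congr_ae ?_
      filter_upwards [hf.ae_differentiableAt (μ := volume)] with z hz
      have h2 : HasFDerivAt (ℓ ∘ f) (ℓ.comp (fderiv ℝ f z)) z :=
        ℓ.hasFDerivAt.comp z hz.hasFDerivAt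
      rw [(h2.hasLineDerivAt v).lineDeriv, map_smul, smul_eq_mul, mul_comm]
      rfl
    rw [h1, h, ← integral_neg]
    refine integral_congr_ae (Eventually.of_forall fun z => ?_)
    simp only
    rw [((hη.differentiable (by simp)).differentiableAt).lineDeriv_eq_fderiv, map_neg, map_smul,
      smul_eq_mul, neg_mul, neg_neg]
    rfl
  apply Complex.ext
  · have := key Complex.reCLM
    rw [Complex.reCLM.integral_comp_comm hi1, Complex.reCLM.integral_comp_comm hi2] at this
    simpa using this
  · have := key Complex.imCLM
    rw [Complex.imCLM.integral_comp_comm hi1, Complex.imCLM.integral_comp_comm hi2] at this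
    simpa using this

end WeakDerivative

theorem ENNReal.le_one_add_sq (x : ℝ≥0∞) : x ≤ 1 + x ^ 2 := by
  rcases le_total x 1 with h | h
  · exact h.trans le_self_add
  · refine le_trans ?_ le_add_self
    rw [sq]
    exact le_mul_of_one_le_left' h

section Quasiconformal

variable {P : ℕ → DiscPacking} {K : ℝ}

theorem tendsto_ofReal_const_mul_quarter_pow (C : ℝ) :
    Tendsto (fun m : ℕ => ENNReal.ofReal (C * (1 / 4) ^ m)) atTop (𝓝 0) := by
  rw [← ENNReal.ofReal_zero, ← mul_zero C]
  exact ENNReal.tendsto_ofReal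
    ((tendsto_pow_atTop_nhds_zero_of_lt_one (by norm_num) (by norm_num)).const_mul _)

theorem volume_limitSet_eq_zero {p : ℝ} (hp : 2 ≤ p) (n : ℕ) : volume (limitSet P p n) = 0 :=
  le_antisymm (ge_of_tendsto' (tendsto_ofReal_const_mul_quarter_pow Real.pi) fun m =>
    (measure_mono (limitSet_subset_levelSet m n)).trans (volume_levelSet_le hp m n)) zero_le

theorem eventuallyEq_of_eq_off_isClosed {f g : ℂ → ℂ} {U : Set ℂ} (hU : IsClosed U)
    (h : ∀ z ∉ U, f z = g z) {z : ℂ} (hz : z ∉ U) : f =ᶠ[𝓝 z] g := by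
  filter_upwards [hU.isOpen_compl.mem_nhds hz] with y hy
  exact h y hy

/-- The limit set is null; any other point avoids some closed level set, and near it φ is a finite
iterate. -/
theorem AEBeltrami.of_eq_off_levelSet (hK : 1 ≤ K) {φ : ℂ → ℂ}
    (h : ∀ m, ∀ z ∉ levelSet P (K + 1) m 0, φ z = stretchIter P (K + 1) 2 m 0 z) :
    AEBeltrami K φ := by
  have h0 : ∀ᵐ z, z ∉ limitSet P (K + 1) 0 :=
    measure_eq_zero_iff_ae_notMem.1 (volume_limitSet_eq_zero (by linarith) 0)
  filter_upwards [h0, ae_all_iff.2 fun m => aeBeltrami_stretchIter (P := P) hK m 0] with z hz hm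
  rw [limitSet, Set.mem_iInter] at hz
  push Not at hz
  obtain ⟨m, hzm⟩ := hz
  have hev := eventuallyEq_of_eq_off_isClosed (isClosed_levelSet m 0) (h m) hzm
  refine ⟨(hm m).1.congr_of_eventuallyEq hev, ?_⟩
  rw [hev.fderiv_eq (𝕜 := ℝ)]
  exact (hm m).2

theorem AEBeltrami.memL2Loc_fderiv {φ : ℂ → ℂ} (hφ : AEBeltrami K φ) (hK : 0 ≤ K)
    (hc : Continuous φ) (hi : Function.Injective φ) : MemL2Loc (fderiv ℝ φ) := by
  intro S hS
  refine ⟨(measurable_fderiv ℝ φ).aestronglyMeasurable, ?_⟩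
  rw [eLpNorm_lt_top_iff_lintegral_rpow_enorm_lt_top two_ne_zero ENNReal.ofNat_ne_top]
  have : (fun z => ‖fderiv ℝ φ z‖ₑ ^ (2 : ℝ≥0∞).toReal) = fun z => ‖fderiv ℝ φ z‖ₑ ^ 2 := by
    funext z; simp
  rw [this]
  refine (hφ.lintegral_enorm_fderiv_sq_le hK hi hS.measurableSet).trans_lt ?_
  exact ENNReal.mul_lt_top ENNReal.ofReal_lt_top (hS.image hc).measure_lt_top

theorem MemL2Loc.locallyIntegrable {F : Type*} [NormedAddCommGroup F] {f : ℂ → F}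
    (hf : MemL2Loc f) : LocallyIntegrable f := by
  rw [locallyIntegrable_iff]
  intro S hS
  have : IsFiniteMeasure (volume.restrict S) := ⟨by
    rw [Measure.restrict_apply_univ]; exact hS.measure_lt_top⟩
  exact (hf S hS).integrable one_le_two

theorem Continuous.memL2Loc {f : ℂ → ℂ} (hf : Continuous f) : MemL2Loc f := by
  intro S hS
  obtain ⟨C, hC⟩ := hS.exists_bound_of_continuousOn hf.continuousOn
  have : IsFiniteMeasure (volume.restrict S) := ⟨by
    rw [Measure.restrict_apply_univ]; exact hS.measure_lt_top⟩
  exact MemLp.of_bound hf.aestronglyMeasurable C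
    ((ae_restrict_iff' hS.measurableSet).2 (Eventually.of_forall hC))

/-- The bound x ≤ 1 + x² reduces the L¹ norm to the areas of the level set and of its image, both at
most π/4^m. The estimate is uniform over the iterates and φ, unlike their Lipschitz constants. -/
theorem lintegral_levelSet_enorm_fderiv_le (hK : 1 ≤ K) {g : ℂ → ℂ} (hg : AEBeltrami K g)
    (hi : Function.Injective g) {m : ℕ}
    (hm : Set.MapsTo g (levelSet P (K + 1) m 0) (levelSet P 2 m 0)) :
    ∫⁻ z in levelSet P (K + 1) m 0, ‖fderiv ℝ g z‖ₑ ≤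
      ENNReal.ofReal ((1 + K) * Real.pi * (1 / 4) ^ m) := by
  calc ∫⁻ z in levelSet P (K + 1) m 0, ‖fderiv ℝ g z‖ₑ
      ≤ ∫⁻ z in levelSet P (K + 1) m 0, (1 + ‖fderiv ℝ g z‖ₑ ^ 2) :=
        lintegral_mono fun z => ENNReal.le_one_add_sq _
    _ = volume (levelSet P (K + 1) m 0) +
          ∫⁻ z in levelSet P (K + 1) m 0, ‖fderiv ℝ g z‖ₑ ^ 2 := by
        rw [lintegral_add_left measurable_const]; simp
    _ ≤ ENNReal.ofReal (Real.pi * (1 / 4) ^ m) +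
          ENNReal.ofReal K * ENNReal.ofReal (Real.pi * (1 / 4) ^ m) := by
        refine add_le_add (volume_levelSet_le (by linarith) m 0)
          ((hg.lintegral_enorm_fderiv_sq_le (by linarith) hi
            (isClosed_levelSet m 0).measurableSet).trans ?_)
        gcongr
        exact (measure_mono hm.image_subset).trans (volume_levelSet_le le_rfl m 0)
    _ = _ := by
        rw [← ENNReal.ofReal_mul (by linarith), ← ENNReal.ofReal_add (by positivity) (by positivity)]
        ring_nf

/-- Integration by parts holds for the Lipschitz iterates. The left sides converge uniformly; on the
right the derivatives differ only on the m-th level set, where both have L¹ norm O(4^(-m)). -/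
theorem integral_fderiv_smul_of_stretch_limit (hK : 1 ≤ K) {φ : ℂ → ℂ} (hc : Continuous φ)
    (hinj : Function.Injective φ)
    (hlim : ∀ m z, ‖stretchIter P (K + 1) 2 m 0 z - φ z‖ ≤ 4 * (1 / 2) ^ m)
    (hoff : ∀ m, ∀ z ∉ levelSet P (K + 1) m 0, φ z = stretchIter P (K + 1) 2 m 0 z)
    (hmaps : ∀ m, Set.MapsTo φ (levelSet P (K + 1) m 0) (levelSet P 2 m 0))
    {η : ℂ → ℝ} (hη : ContDiff ℝ ∞ η) (hηc : HasCompactSupport η) (v : ℂ) :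
    ∫ z, (fderiv ℝ η z v) • φ z = - ∫ z, (η z) • (fderiv ℝ φ z v) := by
  have hp : 2 ≤ K + 1 := by linarith
  have hφK : AEBeltrami K φ := AEBeltrami.of_eq_off_levelSet hK hoff
  have hD : LocallyIntegrable (fderiv ℝ φ) :=
    (hφK.memL2Loc_fderiv (by linarith) hc hinj).locallyIntegrable
  set f : ℕ → ℂ → ℂ := fun m => stretchIter P (K + 1) 2 m 0 with hf
  have hdη : Continuous fun z => fderiv ℝ η z v :=
    (hη.continuous_fderiv (by simp)).clm_apply continuous_const
  have hdηc : HasCompactSupport fun z => fderiv ℝ η z v := hηc.fderiv_apply ℝ v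
  have hI : ∀ g : ℂ → ℂ, Continuous g → Integrable fun z => (fderiv ℝ η z v) • g z := fun g hg =>
    (hdη.smul hg).integrable_of_hasCompactSupport hdηc.smul_right
  have hlip := fun m => (exists_lipschitzWith_stretchIter (P := P) (q := 2) hp m 0).choose_spec
  have hleft : Tendsto (fun m => ∫ z, (fderiv ℝ η z v) • f m z) atTop
      (𝓝 (∫ z, (fderiv ℝ η z v) • φ z)) := by
    rw [tendsto_iff_norm_sub_tendsto_zero]
    have hb : ∀ m, ‖(∫ z, (fderiv ℝ η z v) • f m z) - ∫ z, (fderiv ℝ η z v) • φ z‖ ≤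
        (∫ z, ‖fderiv ℝ η z v‖) * (4 * (1 / 2) ^ m) := by
      intro m
      rw [← integral_sub (hI _ (hlip m).continuous) (hI _ hc), ← integral_mul_const]
      refine norm_integral_le_of_norm_le
        ((hdη.integrable_of_hasCompactSupport hdηc).norm.mul_const _)
        (Eventually.of_forall fun z => ?_)
      rw [← smul_sub, norm_smul]
      exact mul_le_mul_of_nonneg_left (hlim m z) (norm_nonneg _)
    refine squeeze_zero (fun _ => norm_nonneg _) hb ?_
    have := ((tendsto_pow_atTop_nhds_zero_of_lt_one (r := (1 / 2 : ℝ)) (by norm_num)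
      (by norm_num)).const_mul 4).const_mul (∫ z, ‖fderiv ℝ η z v‖)
    simpa using this
  have hright : Tendsto (fun m => ∫ z, (η z) • (fderiv ℝ (f m) z v)) atTop
      (𝓝 (∫ z, (η z) • (fderiv ℝ φ z v))) := by
    obtain ⟨M, hM⟩ := hηc.exists_bound_of_continuous hη.continuous
    have hM0 : 0 ≤ M := (norm_nonneg _).trans (hM 0)
    have hDv : Integrable fun z => η z • fderiv ℝ φ z v := by
      have h1 : LocallyIntegrable fun z => fderiv ℝ φ z v := by
        rw [locallyIntegrable_iff] at hD ⊢
        exact fun S hS => (ContinuousLinearMap.apply ℝ ℂ v).integrable_comp (hD S hS)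
      exact h1.integrable_smul_left_of_hasCompactSupport hη.continuous hηc
    rw [tendsto_iff_edist_tendsto_0]
    set C : ℝ := (M * ‖v‖) * (2 * ((1 + K) * Real.pi)) with hC
    refine tendsto_of_tendsto_of_tendsto_of_le_of_le tendsto_const_nhds
      (tendsto_ofReal_const_mul_quarter_pow C) (fun _ => zero_le) fun m => ?_
    set U := levelSet P (K + 1) m 0 with hU
    have hUm : MeasurableSet U := (isClosed_levelSet m 0).measurableSet
    rw [edist_eq_enorm_sub, ← integral_sub
      (integrable_smul_fderiv_of_lipschitzWith (hlip m) hη.continuous hηc v) hDv]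
    calc ‖∫ z, (η z • fderiv ℝ (f m) z v - η z • fderiv ℝ φ z v)‖ₑ
        ≤ ∫⁻ z, ‖η z • fderiv ℝ (f m) z v - η z • fderiv ℝ φ z v‖ₑ :=
          enorm_integral_le_lintegral_enorm _
      _ ≤ ∫⁻ z, U.indicator (fun z => ENNReal.ofReal (M * ‖v‖) *
            (‖fderiv ℝ (f m) z‖ₑ + ‖fderiv ℝ φ z‖ₑ)) z := by
          refine lintegral_mono fun z => ?_
          by_cases hz : z ∈ U
          · rw [Set.indicator_of_mem hz, ← smul_sub, ← sub_apply,
              ← ofReal_norm, ← ofReal_norm, ← ofReal_norm,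
              ← ENNReal.ofReal_add (norm_nonneg _) (norm_nonneg _),
              ← ENNReal.ofReal_mul (by positivity), norm_smul]
            refine ENNReal.ofReal_le_ofReal ?_
            calc ‖η z‖ * ‖(fderiv ℝ (f m) z - fderiv ℝ φ z) v‖
                ≤ M * ((‖fderiv ℝ (f m) z‖ + ‖fderiv ℝ φ z‖) * ‖v‖) :=
                  mul_le_mul (hM z)
                    (ContinuousLinearMap.le_of_opNorm_le _ (norm_sub_le _ _) v)
                    (norm_nonneg _) hM0
              _ = _ := by ring
          · rw [Set.indicator_of_notMem hz,
              (eventuallyEq_of_eq_off_isClosed (isClosed_levelSet m 0) (hoff m) hz).fderiv_eq,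
              sub_self, enorm_zero]
      _ = ENNReal.ofReal (M * ‖v‖) * ((∫⁻ z in U, ‖fderiv ℝ (f m) z‖ₑ) +
            ∫⁻ z in U, ‖fderiv ℝ φ z‖ₑ) := by
          rw [lintegral_indicator hUm, lintegral_const_mul' _ _ ENNReal.ofReal_ne_top,
            lintegral_add_left (measurable_fderiv ℝ (f m)).enorm]
      _ ≤ ENNReal.ofReal (M * ‖v‖) * (ENNReal.ofReal ((1 + K) * Real.pi * (1 / 4) ^ m) +
            ENNReal.ofReal ((1 + K) * Real.pi * (1 / 4) ^ m)) := by
          gcongr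
          · exact lintegral_levelSet_enorm_fderiv_le hK (aeBeltrami_stretchIter hK m 0)
              (Function.LeftInverse.injective (stretchIter_comp_stretchIter hp le_rfl m 0))
              (mapsTo_stretchIter_levelSet hp le_rfl le_rfl 0)
          · exact lintegral_levelSet_enorm_fderiv_le hK hφK hinj (hmaps m)
      _ = ENNReal.ofReal (C * (1 / 4) ^ m) := by
          rw [← ENNReal.ofReal_add (by positivity) (by positivity),
            ← ENNReal.ofReal_mul (by positivity), hC]
          ring_nf
  refine tendsto_nhds_unique hleft (hright.neg.congr fun m => ?_)
  rw [(hlip m).integral_fderiv_smul hη hηc v]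

theorem exists_isQuasiconformal_image_limitSet (P : ℕ → DiscPacking) (hK : 1 ≤ K) :
    ∃ φ : ℂ → ℂ, IsQuasiconformal K φ ∧ φ '' limitSet P (K + 1) 0 = limitSet P 2 0 := by
  obtain ⟨φ, hhom, hid, hlim, hoff, hmaps, himg⟩ :=
    exists_stretch_limit P (by linarith : 2 ≤ K + 1) le_rfl
  have hc := hhom.continuous
  have hinj := hhom.injective
  have hφK : AEBeltrami K φ := AEBeltrami.of_eq_off_levelSet hK hoff
  have hL2 := hφK.memL2Loc_fderiv (by linarith) hc hinj
  refine ⟨φ, ⟨hhom, orientationPreserving_of_eq_self_of_one_le_norm hc hinj hid, hc.memL2Loc,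
    fderiv ℝ φ, ⟨hc.locallyIntegrable, hL2.locallyIntegrable, fun η hη hηc v => ?_⟩, hL2, ?_⟩, himg⟩
  · exact integral_fderiv_smul_of_stretch_limit hK hc hinj hlim hoff hmaps hη hηc v
  · filter_upwards [hφK] with z hz α β
    exact hz.2.norm_le_mul_norm (by linarith) (Complex.norm_exp_ofReal_mul_I α)
      (Complex.norm_exp_ofReal_mul_I β)

end Quasiconformal

/-! ### Choice of packings, gauges and conclusion -/

theorem exists_packings_volume_limitSet_one_pos :
    ∃ P : ℕ → DiscPacking, 0 < volume (limitSet P 1 0) := by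
  set v : ℕ → ℝ := fun n => 1 - (1 / 2) ^ (n + 1) with hv
  have hpow : ∀ n : ℕ, (0 : ℝ) < (1 / 2) ^ (n + 1) := fun n => by positivity
  have hpow2 : ∀ n : ℕ, ((1 / 2) ^ (n + 1) : ℝ) ≤ 1 / 2 := fun n => by
    rw [pow_succ]
    exact mul_le_of_le_one_left (by norm_num) (pow_le_one₀ (by norm_num) (by norm_num))
  have hv0 : ∀ n, 0 < v n := fun n => by
    have := hpow2 n
    simp only [hv]; linarith
  have hlt : ∀ n, v n < v (n + 1) := fun n => by
    have := hpow n
    simp only [hv]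
    rw [pow_succ _ (n + 1)]; linarith
  -- The n-th packing fills at least the proportion v n / v (n+1) < 1; these ratios telescope,
  -- leaving `v 0` as the lower bound.
  choose P hP using fun n => exists_discPacking ((div_lt_one (hv0 (n + 1))).2 (hlt n))
  refine ⟨P, volume_limitSet_one_pos (v := v) (fun n => ?_) (fun n => ?_) (hv0 0)⟩
  · have := hpow n
    simp only [hv]; linarith
  · exact (div_le_iff₀ (hv0 (n + 1))).1 (hP n)

theorem gaugeHausdorffMeasure_eq_zero {h : ℝ≥0 → ℝ≥0} {t : ℝ} (ht : 0 < t)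
    (h0 : Tendsto h (𝓝[>] 0) (𝓝 0)) (hcont : Continuous h)
    (hlim : Tendsto (fun x : ℝ≥0 => h x / x ^ t) (𝓝[>] 0) (𝓝 0)) {E : Set ℂ}
    (hE : Measure.hausdorffMeasure t E < ⊤) : gaugeHausdorffMeasure h E = 0 := by
  -- The comparison of gauges is also needed at diameter 0, about which the limit of the ratio says
  -- nothing.
  have hzero : h 0 = 0 :=
    tendsto_nhds_unique (hcont.continuousAt.tendsto.mono_left nhdsWithin_le_nhds) h0
  have key : ∀ ε : ℝ≥0, 0 < ε → gaugeHausdorffMeasure h E ≤ ε * Measure.hausdorffMeasure t E := by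
    intro ε hε
    have h1 := hlim.eventually_lt_const hε
    obtain ⟨δ, hδ, hδ'⟩ := (mem_nhdsGT_iff_exists_Ioo_subset' (zero_lt_one' ℝ≥0)).1 h1
    have hle : (fun x : ℝ≥0∞ => (h x.toNNReal : ℝ≥0∞)) ≤ᶠ[𝓝[≥] 0]
        (ε : ℝ≥0∞) • fun x : ℝ≥0∞ => x ^ t := by
      have hnhds : Set.Iio (δ : ℝ≥0∞) ∈ 𝓝[≥] (0 : ℝ≥0∞) :=
        mem_nhdsWithin_of_mem_nhds (Iio_mem_nhds (by exact_mod_cast hδ))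
      filter_upwards [hnhds] with x hx
      lift x to ℝ≥0 using (lt_of_lt_of_le hx le_top).ne
      rw [Pi.smul_apply, smul_eq_mul, ENNReal.toNNReal_coe, ← ENNReal.coe_rpow_of_nonneg _ ht.le]
      norm_cast
      rcases eq_or_ne x 0 with rfl | hx0
      · rw [hzero]; exact zero_le
      · have hxpos : 0 < x := pos_iff_ne_zero.2 hx0
        have := hδ' ⟨hxpos, ENNReal.coe_lt_coe.1 hx⟩
        exact ((div_lt_iff₀ (NNReal.rpow_pos hxpos)).1 this).le
    have := Measure.mkMetric_mono_smul (X := ℂ) (ENNReal.coe_ne_top (r := ε))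
      (by exact_mod_cast hε.ne') hle
    exact this E
  have hlim0 : Tendsto (fun ε : ℝ≥0 => (ε : ℝ≥0∞) * Measure.hausdorffMeasure t E) (𝓝[>] 0)
      (𝓝 (((0 : ℝ≥0) : ℝ≥0∞) * Measure.hausdorffMeasure t E)) := by
    refine ENNReal.Tendsto.mul_const ?_ (Or.inr hE.ne)
    exact (ENNReal.tendsto_coe.2 tendsto_id).mono_left nhdsWithin_le_nhds
  rw [ENNReal.coe_zero, zero_mul] at hlim0
  exact le_antisymm (ge_of_tendsto hlim0 (eventually_nhdsWithin_of_forall key)) zero_le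

theorem corollary3p3 (K : ℝ) (hK : 1 ≤ K) :
    ∃ (E : Set ℂ) (φ : ℂ → ℂ), IsCompact E ∧ IsQuasiconformal K φ ∧
      0 < Measure.hausdorffMeasure (2 / (K + 1)) E ∧
      Measure.hausdorffMeasure (2 / (K + 1)) E < ⊤ ∧
      0 < Measure.hausdorffMeasure 1 (φ '' E) ∧
      Measure.hausdorffMeasure 1 (φ '' E) < ⊤ ∧
      ∀ h : ℝ≥0 → ℝ≥0, IsGaugeFunction h →
        Tendsto (fun t : ℝ≥0 => h t / t ^ (2 / (K + 1) : ℝ)) (𝓝[>] 0) (𝓝 0) →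
        gaugeHausdorffMeasure h E = 0 := by
  obtain ⟨P, hP⟩ := exists_packings_volume_limitSet_one_pos
  obtain ⟨φ, hφ, himg⟩ := exists_isQuasiconformal_image_limitSet P hK
  have hfin := hausdorffMeasure_limitSet_lt_top (P := P) (p := K + 1) (by linarith) 0
  have h1 := hausdorffMeasure_limitSet_pos (P := P) (p := 2) le_rfl hP
  have h2 := hausdorffMeasure_limitSet_lt_top (P := P) (p := 2) one_le_two 0
  -- Exponent 2 gives dimension 2/2 = 1 for the image.
  rw [div_self two_ne_zero] at h1 h2
  refine ⟨limitSet P (K + 1) 0, φ, isCompact_limitSet 0, hφ,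
    hausdorffMeasure_limitSet_pos (by linarith) hP, hfin, himg ▸ h1, himg ▸ h2, fun h hh hlim => ?_⟩
  exact gaugeHausdorffMeasure_eq_zero (by positivity) hh.tendsto_zero hh.continuous hlim hfin
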